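/- Let $k$ be a field. Let $$\mathcal R\xrightarrow{\ i_*=i_!\ }\mathcal T\xrightarrow{\ j^!=j^*\ }\mathcal S$$ be a recollement of compactly generated, locally Hom-finite $k$-linear triangulated categories, with $k$-linear triangle functors $i^*,i^!\colon\mathcal T\to\mathcal R$ and $j_!,j_*\colon\mathcal S\to\mathcal T$. That is, $(i^*,i_*)$, $(i_!,i^!)$, $(j_!,j^!)$ and $(j^*,j_*)$ are adjoint pairs, the functors $i_*$, $j_!$ and $j_*$ are fully faithful, $i^!j_*=0$, and for every $X\in\mathcal T$ the (co)units fit into triangles $i_!i^!X\to X\to j_*j^*X\to i_!i^!X[1]$ and $j_!j^!X\to X\to i_*i^*X\to j_!j^!X[1]$. For $\mathcal C\in\{\mathcal R,\mathcal T,\mathcal S\}$ let $\mathcal C^c$ be the full subcategory of compact objects. Compactly generated means that $\mathcal C$ has small coproducts and that there is a set $\mathcal G$ of compact objects such that $Y=0$ whenever $\operatorname{Hom}_{\mathcal C}(G,Y[n])=0$ for all $G\in\mathcal G$ and $n\in\mathbb Z$. Locally Hom-finite means that $\operatorname{Hom}_{\mathcal C}(X,Y)$ is finite-dimensional over $k$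 for all $X,Y\in\mathcal C^c$. The Brown–Comenetz dual of $\mathcal C^c$ is the smallest thick subcategory of $\mathcal C$ that contains every object $E$ for which there are a compact object $G$ and a natural $k$-linear isomorphism $\operatorname{Hom}_{\mathcal C}(-,E)\cong\operatorname{Hom}_k(\operatorname{Hom}_{\mathcal C}(G,-),k)$. Let $\mathcal E_s,\mathcal E_t,\mathcal E_r$ be the Brown–Comenetz duals of $\mathcal S^c,\mathcal T^c,\mathcal R^c$, respectively. Then $j_*(\mathcal E_s)\subseteq\mathcal E_t$ and $i^!(\mathcal E_t)\subseteq\mathcal E_r$, and the restricted functors $$\mathcal E_s\xrightarrow{\ j_*\ }\mathcal E_t\xrightarrow{\ i^!\ }\mathcal E_r$$ form a short exact sequence up to direct summands. That is, $j_*\colon\mathcal E_s\to\mathcal E_t$ is fully faithful, $i^!j_*=0$ on $\mathcal E_s$, and the functor $\mathcal E_t/j_*(\mathcal E_s)\to\mathcal E_r$ induced by $i^!$ on the Verdier quotient is fully faithful, and every object of $\mathcal E_r$ is a direct summand of an object in its image. -/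

import Mathlib

open CategoryTheory CategoryTheory.Limits CategoryTheory.Pretriangulated Opposite

universe w v u u₁ u₂ u₃

namespace BrownComenetz

section Compact

variable (T : Type u) [Category.{v} T] [Preadditive T]

/-- The compact objects of `T`: those `G` for which `Hom(G, -) : T ⥤ Ab` preserves all
small coproducts. -/
def compacts : ObjectProperty T := fun G =>
  ∀ J : Type v, PreservesColimitsOfShape (Discrete J) (preadditiveCoyoneda.obj (op G))

/-- `T` is compactly generated: it has small coproducts, and there is a small family of compact
objects `G i` such that only a zero object `Y` satisfies `Hom(G i, Y⟦n⟧) = 0` for all `i` and `n`. -/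
structure IsCompactlyGenerated [HasShift T ℤ] : Prop where
  hasCoproducts : HasCoproducts.{v} T
  exists_generators : ∃ (I : Type v) (G : I → T), (∀ i, compacts T (G i)) ∧
    ∀ Y : T, (∀ (i : I) (n : ℤ) (f : G i ⟶ Y⟦n⟧), f = 0) → IsZero Y

variable (k : Type w) [Field k] [Linear k T]

/-- `T` is locally Hom-finite: Hom spaces between compact objects are finite-dimensional. -/
def IsLocallyHomFinite : Prop :=
  ∀ X Y : T, compacts T X → compacts T Y → Module.Finite k (X ⟶ Y)

variable {T}

/-- `E` is a Brown–Comenetz dual of `G`: there is an isomorphism of `k`-linear functors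
`Hom(-, E) ≅ D Hom(G, -)`, where `D = Hom_k(-, k)`. -/
def IsBrownComenetzDual (G E : T) : Prop :=
  ∃ e : ∀ X : T, (X ⟶ E) ≃ₗ[k] Module.Dual k (G ⟶ X),
    ∀ ⦃X Y : T⦄ (f : X ⟶ Y) (g : Y ⟶ E) (h : G ⟶ X), e X (f ≫ g) h = e Y g (h ≫ f)

variable (T)

/-- The Brown–Comenetz duals of the compact objects. By uniqueness of representing objects
this is the essential image of the partial Serre functor defined on the compact objects. -/
def dualsOfCompacts : ObjectProperty T := fun E =>
  ∃ G : T, compacts T G ∧ IsBrownComenetzDual k G E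

instance dualsOfCompacts_nonempty [HasZeroObject T] : (dualsOfCompacts T k).Nonempty := by
  obtain ⟨Z, hZ⟩ := HasZeroObject.zero (C := T)
  have h1 : ∀ X : T, Subsingleton (X ⟶ Z) := fun X => ⟨fun a b => hZ.eq_of_tgt a b⟩
  have h2 : ∀ X : T, Subsingleton (Z ⟶ X) := fun X => ⟨fun a b => hZ.eq_of_src a b⟩
  refine ⟨Z, Z, fun J => ⟨fun {K} => ⟨fun {c} _ => ⟨?_⟩⟩⟩, fun X => 0, ?_⟩
  · have hs : ∀ X : T, IsZero ((preadditiveCoyoneda.obj (op Z)).obj X) := fun X =>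
      @AddCommGrpCat.isZero_of_subsingleton _ (h2 X)
    exact
      { desc := fun s => 0
        fac := fun s j => (hs _).eq_of_src _ _
        uniq := fun s m _ => (hs _).eq_of_src _ _ }
  · intro X Y f g h
    simp

end Compact

section Dual

variable (T : Type u) [Category.{v} T] [Preadditive T] [HasZeroObject T] [HasShift T ℤ]
  [∀ n : ℤ, (shiftFunctor T n).Additive] [Pretriangulated T]
  (k : Type w) [Field k] [Linear k T]

/-- The Brown–Comenetz dual of the subcategory of compact objects of `T`: the smallest thick
(i.e. triangulated and closed under direct summands) subcategory of `T` containing the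
Brown–Comenetz duals of all compact objects. -/
def dualSubcategory : ObjectProperty T := (dualsOfCompacts T k).triangEnvelope

instance : (dualSubcategory T k).IsStableUnderRetracts := by
  unfold dualSubcategory; infer_instance

instance [IsTriangulated T] : (dualSubcategory T k).IsTriangulated := by
  unfold dualSubcategory; infer_instance

end Dual

section Recollement

variable (k : Type w) [Field k]
  (R : Type u₁) [Category.{v} R] [Preadditive R] [HasZeroObject R] [HasShift R ℤ]
  [∀ n : ℤ, (shiftFunctor R n).Additive] [Pretriangulated R] [Linear k R]
  (T : Type u₂) [Category.{v} T] [Preadditive T] [HasZeroObject T] [HasShift T ℤ]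
  [∀ n : ℤ, (shiftFunctor T n).Additive] [Pretriangulated T] [Linear k T]
  (S : Type u₃) [Category.{v} S] [Preadditive S] [HasZeroObject S] [HasShift S ℤ]
  [∀ n : ℤ, (shiftFunctor S n).Additive] [Pretriangulated S] [Linear k S]

/-- A recollement `R → T → S` of `k`-linear triangulated categories. In the usual notation,
`iUpperStar = i^*`, `iLower = i_* = i_!`, `iUpperShriek = i^!`,
`jLowerShriek = j_!`, `jUpper = j^! = j^*`, `jLowerStar = j_*`. -/
structure Recollement where
  iUpperStar : T ⥤ R
  iLower : R ⥤ T
  iUpperShriek : T ⥤ R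
  jLowerShriek : S ⥤ T
  jUpper : T ⥤ S
  jLowerStar : S ⥤ T
  [iUpperStar_commShift : iUpperStar.CommShift ℤ]
  [iLower_commShift : iLower.CommShift ℤ]
  [iUpperShriek_commShift : iUpperShriek.CommShift ℤ]
  [jLowerShriek_commShift : jLowerShriek.CommShift ℤ]
  [jUpper_commShift : jUpper.CommShift ℤ]
  [jLowerStar_commShift : jLowerStar.CommShift ℤ]
  [iUpperStar_isTriangulated : iUpperStar.IsTriangulated]
  [iLower_isTriangulated : iLower.IsTriangulated]
  [iUpperShriek_isTriangulated : iUpperShriek.IsTriangulated]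
  [jLowerShriek_isTriangulated : jLowerShriek.IsTriangulated]
  [jUpper_isTriangulated : jUpper.IsTriangulated]
  [jLowerStar_isTriangulated : jLowerStar.IsTriangulated]
  [iUpperStar_linear : iUpperStar.Linear k]
  [iLower_linear : iLower.Linear k]
  [iUpperShriek_linear : iUpperShriek.Linear k]
  [jLowerShriek_linear : jLowerShriek.Linear k]
  [jUpper_linear : jUpper.Linear k]
  [jLowerStar_linear : jLowerStar.Linear k]
  iAdjLeft : iUpperStar ⊣ iLower
  iAdjRight : iLower ⊣ iUpperShriek
  jAdjLeft : jLowerShriek ⊣ jUpper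
  jAdjRight : jUpper ⊣ jLowerStar
  iLower_full : iLower.Full
  iLower_faithful : iLower.Faithful
  jLowerShriek_full : jLowerShriek.Full
  jLowerShriek_faithful : jLowerShriek.Faithful
  jLowerStar_full : jLowerStar.Full
  jLowerStar_faithful : jLowerStar.Faithful
  isZero_iUpperShriek_jLowerStar : ∀ X : S, IsZero (iUpperShriek.obj (jLowerStar.obj X))
  /-- The triangle `i_! i^! X ⟶ X ⟶ j_* j^* X ⟶ (i_! i^! X)⟦1⟧`. -/
  exists_triangle_right : ∀ X : T,
    ∃ δ : jLowerStar.obj (jUpper.obj X) ⟶ (iLower.obj (iUpperShriek.obj X))⟦(1 : ℤ)⟧,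
      Triangle.mk (iAdjRight.counit.app X) (jAdjRight.unit.app X) δ ∈ distTriang T
  /-- The triangle `j_! j^! X ⟶ X ⟶ i_* i^* X ⟶ (j_! j^! X)⟦1⟧`. -/
  exists_triangle_left : ∀ X : T,
    ∃ δ : iLower.obj (iUpperStar.obj X) ⟶ (jLowerShriek.obj (jUpper.obj X))⟦(1 : ℤ)⟧,
      Triangle.mk (jAdjLeft.counit.app X) (iAdjLeft.unit.app X) δ ∈ distTriang T

attribute [instance] Recollement.iUpperStar_commShift Recollement.iLower_commShift
  Recollement.iUpperShriek_commShift Recollement.jLowerShriek_commShift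
  Recollement.jUpper_commShift Recollement.jLowerStar_commShift
  Recollement.iUpperStar_isTriangulated Recollement.iLower_isTriangulated
  Recollement.iUpperShriek_isTriangulated Recollement.jLowerShriek_isTriangulated
  Recollement.jUpper_isTriangulated Recollement.jLowerStar_isTriangulated
  Recollement.iUpperStar_linear Recollement.iLower_linear
  Recollement.iUpperShriek_linear Recollement.jLowerShriek_linear
  Recollement.jUpper_linear Recollement.jLowerStar_linear

end Recollement

section Exact

variable {A : Type u₁} [Category.{v} A]
  {B : Type u₂} [Category.{v} B] [Preadditive B] [HasZeroObject B] [HasShift B ℤ]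
  [∀ n : ℤ, (shiftFunctor B n).Additive] [Pretriangulated B]
  {C : Type u₃} [Category.{v} C] [Preadditive C] [HasZeroObject C] [HasShift C ℤ]
  [∀ n : ℤ, (shiftFunctor C n).Additive] [Pretriangulated C]

/-- The morphisms of `B` whose cone lies in the essential image of `F : A ⥤ B`. -/
def verdierW (F : A ⥤ B) : MorphismProperty B := F.essImage.trW

/-- If `G F = 0`, the triangle functor `G` inverts all morphisms with cone in the essential
image of `F`. -/
theorem verdierW_isInvertedBy (F : A ⥤ B) (G : B ⥤ C) [G.CommShift ℤ] [G.IsTriangulated]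
    (h : ∀ X : A, IsZero (G.obj (F.obj X))) : (verdierW F).IsInvertedBy G := by
  rintro X Y f ⟨Z, a, b, hT, ⟨W, ⟨e⟩⟩⟩
  have hG := G.map_distinguished _ hT
  exact (Triangle.isZero₃_iff_isIso₁ _ hG).1 ((h W).of_iso (G.mapIso e.symm))

/-- The functor `B/A ⥤ C` on the Verdier quotient (by the essential image of `F : A ⥤ B`)
induced by `G : B ⥤ C` with `G F = 0`. -/
noncomputable def verdierInduced (F : A ⥤ B) (G : B ⥤ C) [G.CommShift ℤ] [G.IsTriangulated]
    (h : ∀ X : A, IsZero (G.obj (F.obj X))) : (verdierW F).Localization ⥤ C :=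
  Localization.Construction.lift G (verdierW_isInvertedBy F G h)

variable [Preadditive A] [HasZeroObject A] [HasShift A ℤ]
  [∀ n : ℤ, (shiftFunctor A n).Additive] [Pretriangulated A]

/-- A sequence `A ⥤ B ⥤ C` of triangle functors is a short exact sequence up to direct summands
if `F` is fully faithful, `G F = 0`, and the induced functor `B/A ⥤ C` is an equivalence up to
direct summands: it is fully faithful and every object of `C` is a direct summand of
an object in its image. -/
structure IsShortExactUpToSummands (F : A ⥤ B) (G : B ⥤ C) [F.CommShift ℤ] [F.IsTriangulated]
    [G.CommShift ℤ] [G.IsTriangulated] : Prop where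
  full : F.Full
  faithful : F.Faithful
  isZero_comp : ∀ X : A, IsZero (G.obj (F.obj X))
  induced_full : (verdierInduced F G isZero_comp).Full
  induced_faithful : (verdierInduced F G isZero_comp).Faithful
  dense : ∀ Y : C, ∃ X : (verdierW F).Localization,
    Nonempty (Retract Y ((verdierInduced F G isZero_comp).obj X))

end Exact

end BrownComenetz

/-! Write `D G` for the Brown–Comenetz dual of a compact object `G`. Brown representability
(`CohFunctor.exists_representation`) shows that every compact `G` has one. Finite-dimensionality of
Hom between compacts makes transposition (`AreTransposed`) a bijection between maps `G ⟶ H` and maps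
`D G ⟶ D H`, and duality carries cones to cones (`exists_isTrace_cone`). Hence the duals of compacts
already form a triangulated subcategory, and the thick subcategory they generate consists of their
retracts (`dualSubcategory_le_retractClosure`).

For adjunctions `L ⊣ M ⊣ N` one has `N (D G) = D (L G)` (`IsTrace.adjForm`). So `j_*` and `i^!` on
duals are `j_!` and `i^*` on compacts seen through `D`, and the theorem is the dual of Neeman's
localization theorem: `S^c → T^c → R^c` is exact up to summands.

That theorem rests on one fact: a map from a compact object to any `j_! W` factors through `j_!` of
a compact object (`Recollement.compactFactor_jLowerShriek`). Consequently maps of compacts killed by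
`i^*` factor through `j_!` of a compact (`Recollement.exists_factor`), and maps `i^* A ⟶ i^* B` are
fractions of maps of compacts (`Recollement.exists_roof`). The same factorization argument in `R`
makes every compact of `R` a summand of some `i^* H` (`Recollement.exists_retract_iUpperStar`).
Transposing the three statements gives faithfulness, fullness and density of the induced functor. -/

namespace BrownComenetz

/-! ### Compactness as surjectivity of `⨁ Hom(G, X j) → Hom(G, ∐ X)` -/

section Compact

variable {T : Type u} [Category.{v} T] [Preadditive T]

open Classical in
/-- The canonical map `⨁ Hom(G, X j) → Hom(G, ∐ X)`. -/
noncomputable def sumToSigma (G : T) {J : Type v} (X : J → T) [HasCoproduct X] :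
    (DirectSum J fun j => (G ⟶ X j)) →+ (G ⟶ ∐ X) :=
  DirectSum.toAddMonoid fun j => Preadditive.rightComp G (Sigma.ι X j)

@[simp]
lemma sumToSigma_of (G : T) {J : Type v} [DecidableEq J] (X : J → T) [HasCoproduct X]
    (j : J) (g : G ⟶ X j) :
    sumToSigma G X (DirectSum.of (fun j => (G ⟶ X j)) j g) = g ≫ Sigma.ι X j := by
  unfold sumToSigma
  convert DirectSum.toAddMonoid_of (β := fun j => (G ⟶ X j))
    (fun j => Preadditive.rightComp G (Sigma.ι X j)) j g
  rfl

open Classical in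
lemma sumToSigma_eq_sum (G : T) {J : Type v} (X : J → T) [HasCoproduct X]
    (g : DirectSum J fun j => (G ⟶ X j)) :
    sumToSigma G X g = ∑ j ∈ DFinsupp.support g, g j ≫ Sigma.ι X j := by
  conv_lhs => rw [← DirectSum.sum_support_of g]
  rw [map_sum]
  simp

/-- The `Sigma.desc` here is the projection of the coproduct onto its `i`-th summand, available
because Hom groups have zero. It makes `sumToSigma` injective for every `G`, so compactness is a
matter of surjectivity alone. -/
lemma sumToSigma_comp_desc (G : T) {J : Type v} [DecidableEq J] (X : J → T) [HasCoproduct X]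
    (g : DirectSum J fun j => (G ⟶ X j)) (i : J) :
    sumToSigma G X g ≫ Sigma.desc (fun j => if h : j = i then eqToHom (by rw [h]) else 0) =
      g i := by
  induction g using DirectSum.induction_on with
  | zero => simp
  | of j x =>
    simp only [sumToSigma_of, Category.assoc, colimit.ι_desc, Cofan.mk_ι_app]
    by_cases h : j = i
    · subst h; simp
    · simp [h, DirectSum.of_eq_of_ne, Ne.symm h]
  | add a b ha hb => simp [ha, hb]

lemma sumToSigma_injective (G : T) {J : Type v} (X : J → T) [HasCoproduct X] :
    Function.Injective (sumToSigma G X) := by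
  classical
  intro a b h
  refine DFinsupp.ext fun i => ?_
  rw [← sumToSigma_comp_desc, ← sumToSigma_comp_desc, h]

lemma comp_ι_mem_range (G : T) {J : Type v} (X : J → T) [HasCoproduct X] (j : J) (g : G ⟶ X j) :
    g ≫ Sigma.ι X j ∈ (sumToSigma G X).range := by
  classical
  exact ⟨DirectSum.of _ j g, sumToSigma_of G X j g⟩

lemma comp_mem_range {G G' : T} (h : G' ⟶ G) {J : Type v} (X : J → T) [HasCoproduct X]
    {f : G ⟶ ∐ X} (hf : f ∈ (sumToSigma G X).range) : h ≫ f ∈ (sumToSigma G' X).range := by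
  classical
  obtain ⟨g, rfl⟩ := hf
  rw [sumToSigma_eq_sum, Preadditive.comp_sum]
  exact AddSubgroup.sum_mem _ fun j _ => by
    rw [← Category.assoc]
    exact comp_ι_mem_range _ _ _ _

lemma sumToSigma_hom_ext {G : T} {J : Type v} {X : J → T} [HasCoproduct X]
    (h : Function.Surjective (sumToSigma G X)) {M : Type*} [AddCommGroup M]
    {φ ψ : (G ⟶ ∐ X) →+ M}
    (hφ : ∀ (j : J) (g : G ⟶ X j), φ (g ≫ Sigma.ι X j) = ψ (g ≫ Sigma.ι X j)) : φ = ψ := by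
  classical
  ext f
  obtain ⟨g, rfl⟩ := h f
  simp [sumToSigma_eq_sum, hφ]

lemma exists_addMonoidHom_of_surjective {G : T} {J : Type v} {X : J → T} [HasCoproduct X]
    (h : Function.Surjective (sumToSigma G X)) {M : Type*} [AddCommGroup M]
    (s : ∀ j, (G ⟶ X j) →+ M) :
    ∃ φ : (G ⟶ ∐ X) →+ M, ∀ (j : J) (g : G ⟶ X j), φ (g ≫ Sigma.ι X j) = s j g := by
  classical
  let Φ := AddEquiv.ofBijective (sumToSigma G X) ⟨sumToSigma_injective G X, h⟩
  refine ⟨(DirectSum.toAddMonoid s).comp Φ.symm.toAddMonoidHom, fun j g => ?_⟩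
  have : Φ.symm (g ≫ Sigma.ι X j) = DirectSum.of (fun j => (G ⟶ X j)) j g := by
    rw [AddEquiv.symm_apply_eq]
    exact (sumToSigma_of G X j g).symm
  change DirectSum.toAddMonoid s (Φ.symm (g ≫ Sigma.ι X j)) = _
  rw [this, DirectSum.toAddMonoid_of]

/-- The projection onto the cokernel of `sumToSigma` vanishes on each `Hom(G, X j)`. Since `Hom(G,
-)` preserves the coproduct, it must then be zero. -/
lemma sumToSigma_surjective {G : T} (hG : compacts T G) {J : Type v} (X : J → T)
    [HasCoproduct X] : Function.Surjective (sumToSigma G X) := by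
  have := hG J
  have hq : (AddCommGrpCat.ofHom (QuotientAddGroup.mk' (sumToSigma G X).range) :
      (preadditiveCoyoneda.obj (op G)).obj (∐ X) ⟶ _) = 0 := by
    refine (isColimitOfPreserves (preadditiveCoyoneda.obj (op G))
      (coproductIsCoproduct X)).hom_ext fun ⟨j⟩ => ?_
    ext g
    exact (QuotientAddGroup.eq_zero_iff _).2 (comp_ι_mem_range G X j g)
  exact fun f => (QuotientAddGroup.eq_zero_iff f).1 congr($hq f)

lemma compacts_of_surjective [HasCoproducts.{v} T] {G : T}
    (h : ∀ (J : Type v) (X : J → T), Function.Surjective (sumToSigma G X)) : compacts T G := by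
  intro J
  have (X : J → T) : PreservesColimit (Discrete.functor X) (preadditiveCoyoneda.obj (op G)) := by
    refine preservesColimit_of_preserves_colimit_cocone (coproductIsCoproduct X) ?_
    refine (isColimitMapCoconeCofanMkEquiv _ _ _).symm ?_
    refine Cofan.IsColimit.mk _ (fun s => AddCommGrpCat.ofHom
      (exists_addMonoidHom_of_surjective (h J X) (fun j => (s.inj j).hom)).choose) ?_ ?_
    · intro s j
      ext g
      exact (exists_addMonoidHom_of_surjective (h J X) (fun j => (s.inj j).hom)).choose_spec j g
    · intro s m hm
      refine AddCommGrpCat.hom_ext (sumToSigma_hom_ext (h J X) fun j g => ?_)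
      refine Eq.trans congr($(hm j) g) ?_
      exact ((exists_addMonoidHom_of_surjective (h J X)
        (fun j => (s.inj j).hom)).choose_spec j g).symm
  exact preservesColimitsOfShape_of_discrete _

lemma compacts_of_adjunction {T' : Type u₁} [Category.{v} T'] [Preadditive T'] {L : T ⥤ T'}
    {R : T' ⥤ T} (adj : L ⊣ R) [R.Additive] [∀ J : Type v, PreservesColimitsOfShape (Discrete J) R]
    {G : T} (hG : compacts T G) : compacts T' (L.obj G) := by
  intro J
  have := hG J
  have := adj.left_adjoint_additive
  let e : preadditiveCoyoneda.obj (op (L.obj G)) ≅ R ⋙ preadditiveCoyoneda.obj (op G) :=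
    NatIso.ofComponents (fun X => AddEquiv.toAddCommGrpIso (adj.homAddEquiv G X)) (by
      intro X Y f
      ext g
      exact adj.homEquiv_naturality_right g f)
  exact preservesColimitsOfShape_of_natIso e.symm

lemma compacts_shift [HasShift T ℤ] [∀ n : ℤ, (shiftFunctor T n).Additive] {G : T}
    (hG : compacts T G) (n : ℤ) : compacts T (G⟦n⟧) :=
  have : (shiftEquiv T n).inverse.Additive := inferInstanceAs (shiftFunctor T (-n)).Additive
  compacts_of_adjunction (shiftEquiv T n).toAdjunction hG

instance : (compacts T).IsClosedUnderIsomorphisms where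
  of_iso e h := fun J => by
    have := h J
    exact preservesColimitsOfShape_of_natIso (preadditiveCoyoneda.mapIso e.op.symm)

end Compact

/-! ### Compact objects form a triangulated subcategory; diagram chases in triangles -/

section

variable {T : Type u} [Category.{v} T] [Preadditive T] [HasZeroObject T] [HasShift T ℤ]
  [∀ n : ℤ, (shiftFunctor T n).Additive] [Pretriangulated T]

lemma compacts_isTriangulated [HasCoproducts.{v} T] : (compacts T).IsTriangulated := by
  classical
  have : (compacts T).ContainsZero := open ZeroObject in
    ⟨0, isZero_zero T, compacts_of_surjective fun J X f =>
    ⟨0, (isZero_zero T).eq_of_src _ _⟩⟩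
  have : (compacts T).IsStableUnderShift ℤ := ⟨fun n => ⟨fun G hG => compacts_shift hG n⟩⟩
  have : (compacts T).IsTriangulatedClosed₂ := .mk' (by
    intro Δ hΔ h₁ h₃
    refine compacts_of_surjective fun J X f => ?_
    obtain ⟨a, ha⟩ := sumToSigma_surjective h₁ X (Δ.mor₁ ≫ f)
    -- The restriction of `f` to the first vertex has finite support. Subtracting the components of
    -- `f` over that support gives a map that vanishes on the first vertex, hence factors through
    -- the third.
    obtain ⟨b, hb⟩ := Triangle.yoneda_exact₂ _ hΔ (f - ∑ j ∈ DFinsupp.support a,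
      (f ≫ Sigma.desc (fun i => if h : i = j then eqToHom (by rw [h]) else 0)) ≫ Sigma.ι X j) (by
        rw [Preadditive.comp_sub, ← ha, Preadditive.comp_sum, sub_eq_zero, sumToSigma_eq_sum]
        refine Finset.sum_congr rfl fun j _ => ?_
        rw [← Category.assoc, ← Category.assoc, ← ha, sumToSigma_comp_desc])
    rw [← AddMonoidHom.mem_range, ← sub_add_cancel f (∑ j ∈ DFinsupp.support a,
      (f ≫ Sigma.desc (fun i => if h : i = j then eqToHom (by rw [h]) else 0)) ≫ Sigma.ι X j), hb]
    exact AddSubgroup.add_mem _ (comp_mem_range _ _ (sumToSigma_surjective h₃ X b))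
      (AddSubgroup.sum_mem _ fun j _ => comp_ι_mem_range _ _ _ _))
  constructor

section

variable {X Y Z : T} {a : X ⟶ Y} {b : Y ⟶ Z} {c : Z ⟶ X⟦(1 : ℤ)⟧}
  (h : Triangle.mk a b c ∈ distTriang T) {W : T}

include h

lemma distTriang_comp₁₂ : a ≫ b = 0 := comp_distTriang_mor_zero₁₂ _ h

lemma distTriang_comp₂₃ : b ≫ c = 0 := comp_distTriang_mor_zero₂₃ _ h

lemma distTriang_comp₃₁ : c ≫ a⟦(1 : ℤ)⟧' = 0 := comp_distTriang_mor_zero₃₁ _ h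

lemma distTriang_desc₂ (f : Y ⟶ W) (hf : a ≫ f = 0) : ∃ g : Z ⟶ W, b ≫ g = f := by
  obtain ⟨g, hg⟩ := Triangle.yoneda_exact₂ _ h f hf
  exact ⟨g, hg.symm⟩

lemma distTriang_desc₃ (f : Z ⟶ W) (hf : b ≫ f = 0) : ∃ g : X⟦(1 : ℤ)⟧ ⟶ W, c ≫ g = f := by
  obtain ⟨g, hg⟩ := Triangle.yoneda_exact₃ _ h f hf
  exact ⟨g, hg.symm⟩

lemma distTriang_lift₂ (f : W ⟶ Y) (hf : f ≫ b = 0) : ∃ g : W ⟶ X, g ≫ a = f := by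
  obtain ⟨g, hg⟩ := Triangle.coyoneda_exact₂ _ h f hf
  exact ⟨g, hg.symm⟩

lemma distTriang_lift₃ (f : W ⟶ Z) (hf : f ≫ c = 0) : ∃ g : W ⟶ Y, g ≫ b = f := by
  obtain ⟨g, hg⟩ := Triangle.coyoneda_exact₃ _ h f hf
  exact ⟨g, hg.symm⟩

lemma distTriang_lift₁ (f : W ⟶ X⟦(1 : ℤ)⟧) (hf : f ≫ a⟦(1 : ℤ)⟧' = 0) :
    ∃ g : W ⟶ Z, g ≫ c = f := by
  obtain ⟨g, hg⟩ := Triangle.coyoneda_exact₁ _ h f hf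
  exact ⟨g, hg.symm⟩

lemma distTriang_of_iso₃ (e : Z ≅ W) : Triangle.mk a (b ≫ e.hom) (e.inv ≫ c) ∈ distTriang T :=
  isomorphic_distinguished _ h _ (Triangle.isoMk _ _ (Iso.refl X) (Iso.refl Y) e.symm
    ((Category.comp_id a).trans (Category.id_comp a).symm)
    (((e.comp_inv_eq).2 rfl).trans (Category.id_comp b).symm)
    (((congr((e.inv ≫ c) ≫ $((shiftFunctor T (1 : ℤ)).map_id X))).trans (Category.comp_id _))))

variable {X' Y' Z' : T} {a' : X' ⟶ Y'} {b' : Y' ⟶ Z'} {c' : Z' ⟶ X'⟦(1 : ℤ)⟧}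
  (h' : Triangle.mk a' b' c' ∈ distTriang T)

include h'

lemma distTriang_complete₁ (y : Y ⟶ Y') (z : Z ⟶ Z') (hyz : b ≫ z = y ≫ b') :
    ∃ x : X ⟶ X', a ≫ y = x ≫ a' ∧ c ≫ x⟦(1 : ℤ)⟧' = z ≫ c' :=
  complete_distinguished_triangle_morphism₁ _ _ h h' y z hyz

lemma distTriang_complete₂ (x : X ⟶ X') (z : Z ⟶ Z') (hxz : c ≫ x⟦(1 : ℤ)⟧' = z ≫ c') :
    ∃ y : Y ⟶ Y', a ≫ y = x ≫ a' ∧ b ≫ z = y ≫ b' :=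
  complete_distinguished_triangle_morphism₂ _ _ h h' x z hxz

end

end
-- Brown representability and localizing subcategories
section Brown

variable {T : Type u} [Category.{v} T] [HasShift T ℤ]

/-- A morphism into a shifted object is determined by the corresponding morphism out of the
inversely shifted object. -/
lemma exists_unshift {G Y : T} (n : ℤ) (f : G ⟶ Y⟦n⟧) :
    ∃ g : G⟦-n⟧ ⟶ Y, (shiftNegShift G n).hom ≫ f = g⟦n⟧' :=
  ⟨(shiftFunctor T n).preimage ((shiftNegShift G n).hom ≫ f), by simp⟩

variable [Preadditive T] [∀ n : ℤ, (shiftFunctor T n).Additive]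

lemma eq_zero_of_comp_shift_eq_zero {G X Y : T} {α : X ⟶ Y}
    (hα : ∀ g : G⟦(-1 : ℤ)⟧ ⟶ X, g ≫ α = 0 → g = 0) {f : G ⟶ X⟦(1 : ℤ)⟧}
    (hf : f ≫ α⟦(1 : ℤ)⟧' = 0) : f = 0 := by
  obtain ⟨g, hg⟩ := exists_unshift 1 f
  have : g = 0 := hα g ((shiftFunctor T (1 : ℤ)).map_injective (by
    rw [Functor.map_comp, ← hg, Category.assoc, hf, comp_zero, Functor.map_zero]))
  rw [← cancel_epi (shiftNegShift G (1 : ℤ)).hom, hg, this, Functor.map_zero, comp_zero]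

/-- A small family of compact objects, stable under negative shift, that detects zero objects. -/
structure IsCompactGenerating {I : Type v} (G : I → T) : Prop where
  compact : ∀ i, compacts T (G i)
  shift : ∀ i, ∃ i', Nonempty (G i' ≅ (G i)⟦(-1 : ℤ)⟧)
  isZero : ∀ Y : T, (∀ (i : I) (f : G i ⟶ Y), f = 0) → IsZero Y

lemma IsCompactlyGenerated.exists_isCompactGenerating (h : IsCompactlyGenerated T) :
    ∃ (I : Type v) (G : I → T), IsCompactGenerating G := by
  obtain ⟨I, G, hG, hG'⟩ := h.exists_generators
  refine ⟨I × ℤ, fun p => (G p.1)⟦p.2⟧, fun p => compacts_shift (hG p.1) p.2, fun p =>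
    ⟨(p.1, p.2 + (-1)), ⟨(shiftFunctorAdd T p.2 (-1)).app (G p.1)⟩⟩, fun Y hY =>
      hG' Y fun i n f => ?_⟩
  have h0 := hY (i, -n) (f⟦-n⟧' ≫ (shiftShiftNeg Y n).hom)
  rw [Preadditive.IsIso.comp_right_eq_zero] at h0
  exact (shiftFunctor T (-n)).map_injective (by rw [h0, Functor.map_zero])

variable [HasZeroObject T] [Pretriangulated T]

/-- The cone receives no nonzero map from a generator: injectivity, applied to the generator shifted
by `-1`, makes such a map lift to `Y`, and surjectivity lifts it on to `X`. -/
lemma IsCompactGenerating.isIso {I : Type v} {G : I → T} (hG : IsCompactGenerating G)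
    {X Y : T} (α : X ⟶ Y) (h : ∀ i, Function.Bijective fun f : G i ⟶ X => f ≫ α) : IsIso α := by
  obtain ⟨C, β, δ, hΔ⟩ := distinguished_cocone_triangle α
  refine (Triangle.isZero₃_iff_isIso₁ _ hΔ).1 (hG.isZero C fun i f => ?_)
  have hδ : f ≫ δ = 0 := by
    refine eq_zero_of_comp_shift_eq_zero (α := α) (fun g hg => ?_) ?_
    · obtain ⟨i', ⟨e⟩⟩ := hG.shift i
      rw [← cancel_epi e.hom, comp_zero]
      exact (h i').1 (by simp [hg])
    · rw [Category.assoc, distTriang_comp₃₁ hΔ, comp_zero]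
  obtain ⟨g, rfl⟩ := distTriang_lift₃ hΔ f hδ
  obtain ⟨g', rfl⟩ := (h i).2 g
  dsimp only
  rw [Category.assoc, distTriang_comp₁₂ hΔ, comp_zero]

variable (T) in
/-- A contravariant cohomological functor to abelian groups which turns small coproducts
into products. -/
structure CohFunctor where
  /-- the value on objects -/
  obj : T → Type w
  [group : ∀ X, AddCommGroup (obj X)]
  /-- the value on morphisms -/
  map : ∀ {X Y : T}, (X ⟶ Y) → (obj Y →+ obj X)
  map_id : ∀ {X : T} (x : obj X), map (𝟙 X) x = x
  map_comp : ∀ {X Y Z : T} (f : X ⟶ Y) (g : Y ⟶ Z) (z : obj Z), map (f ≫ g) z = map f (map g z)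
  map_add : ∀ {X Y : T} (f g : X ⟶ Y) (y : obj Y), map (f + g) y = map f y + map g y
  exact : ∀ {X Y Z : T} {a : X ⟶ Y} {b : Y ⟶ Z} {c : Z ⟶ X⟦(1 : ℤ)⟧},
    Triangle.mk a b c ∈ distTriang T → ∀ y : obj Y, map a y = 0 → ∃ z, map b z = y
  exists_sigma : ∀ {J : Type v} (X : J → T) [HasCoproduct X] (x : ∀ j, obj (X j)),
    ∃ z : obj (∐ X), ∀ j, map (Sigma.ι X j) z = x j
  sigma_ext : ∀ {J : Type v} (X : J → T) [HasCoproduct X] (z : obj (∐ X)),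
    (∀ j, map (Sigma.ι X j) z = 0) → z = 0

attribute [instance] CohFunctor.group

namespace CohFunctor

variable (H : CohFunctor.{w} T)

lemma map_sub {X Y : T} (f g : X ⟶ Y) (y : H.obj Y) :
    H.map (f - g) y = H.map f y - H.map g y := by
  rw [eq_sub_iff_add_eq, ← H.map_add, sub_add_cancel]

/-- The functor `Hom(-, W)`. -/
def hom (W : T) : CohFunctor.{v} T where
  obj X := X ⟶ W
  map f := Preadditive.leftComp W f
  map_id := Category.id_comp
  map_comp f g z := Category.assoc f g z
  map_add f g y := Preadditive.add_comp _ _ _ f g y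
  exact hΔ x hx := distTriang_desc₂ hΔ x hx
  exists_sigma _ _ x := ⟨Sigma.desc x, Sigma.ι_desc x⟩
  sigma_ext _ _ _ h := Sigma.hom_ext _ _ fun j => (h j).trans comp_zero.symm

section

variable [HasCoproducts.{v} T] {I : Type v} {G : I → T} {P : ObjectProperty T}

/-- Add to `X` one copy of `G i` for each element of `H (G i)`; smallness of these groups keeps the
index set in `Type v`. The predicate `P` records that the construction stays inside a given
localizing subcategory. -/
lemma exists_surjective [∀ i, Small.{v} (H.obj (G i))] (hPG : ∀ i, P (G i))
    (hP : ∀ (J : Type v) (X : J → T), (∀ j, P (X j)) → P (∐ X)) (X : T) (x : H.obj X) :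
    ∃ (Y : T) (y : H.obj Y) (φ : X ⟶ Y), H.map φ y = x ∧ (P X → P Y) ∧
      ∀ (i : I) (z : H.obj (G i)), ∃ f : G i ⟶ Y, H.map f y = z := by
  let J := Option (Σ i, Shrink.{v} (H.obj (G i)))
  let F : J → T := fun j => j.elim X fun p => G p.1
  let a : ∀ j, H.obj (F j) := fun j => match j with
    | none => x
    | some p => (equivShrink (H.obj (G p.1))).symm p.2
  obtain ⟨y, hy⟩ := H.exists_sigma F a
  refine ⟨∐ F, y, Sigma.ι F none, hy none, fun hX => hP _ _ fun j => ?_, fun i z =>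
    ⟨Sigma.ι F (some ⟨i, equivShrink _ z⟩), ?_⟩⟩
  · cases j with
    | none => exact hX
    | some p => exact hPG p.1
  · exact (hy _).trans ((equivShrink _).symm_apply_apply z)

/-- Take the cone of the coproduct of all maps `G i ⟶ X` that kill `x`; exactness extends `x` over
the cone. -/
lemma exists_kill [P.IsTriangulated] [P.IsClosedUnderIsomorphisms] (hPG : ∀ i, P (G i))
    (hP : ∀ (J : Type v) (X : J → T), (∀ j, P (X j)) → P (∐ X)) (X : T) (x : H.obj X) :
    ∃ (Y : T) (y : H.obj Y) (φ : X ⟶ Y), H.map φ y = x ∧ (P X → P Y) ∧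
      ∀ (i : I) (f : G i ⟶ X), H.map f x = 0 → f ≫ φ = 0 := by
  let J := Σ i, { f : G i ⟶ X // H.map f x = 0 }
  let F : J → T := fun j => G j.1
  let a : ∐ F ⟶ X := Sigma.desc fun j => j.2.1
  have ha : H.map a x = 0 := H.sigma_ext F _ fun j => by
    rw [← H.map_comp, Sigma.ι_desc]
    exact j.2.2
  obtain ⟨Y, φ, δ, hΔ⟩ := distinguished_cocone_triangle a
  obtain ⟨y, hy⟩ := H.exact hΔ x ha
  refine ⟨Y, y, φ, hy, fun hX => P.ext_of_isTriangulatedClosed₃ _ hΔ (hP _ _ fun j => hPG j.1) hX,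
    fun i f hf => ?_⟩
  have h1 : f = Sigma.ι F ⟨i, f, hf⟩ ≫ a := (Sigma.ι_desc (f := F) (fun j => j.2.1) ⟨i, f, hf⟩).symm
  have h2 : a ≫ φ = 0 := distTriang_comp₁₂ hΔ
  rw [h1, Category.assoc, h2, comp_zero]

/-- Sequential homotopy colimits. -/
lemma exists_hocolim [P.IsTriangulated] [P.IsClosedUnderIsomorphisms]
    (hP : ∀ (J : Type v) (X : J → T), (∀ j, P (X j)) → P (∐ X))
    (X : ℕ → T) (φ : ∀ n, X n ⟶ X (n + 1)) (x : ∀ n, H.obj (X n))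
    (hx : ∀ n, H.map (φ n) (x (n + 1)) = x n) :
    ∃ (Y : T) (y : H.obj Y) (ψ : ∀ n, X n ⟶ Y), (∀ n, φ n ≫ ψ (n + 1) = ψ n) ∧
      (∀ n, H.map (ψ n) y = x n) ∧ ((∀ n, P (X n)) → P Y) ∧
      ∀ (G : T), compacts T G → ∀ f : G ⟶ Y, ∃ (n : ℕ) (g : G ⟶ X n), g ≫ ψ n = f := by
  let F : ULift.{v} ℕ → T := fun n => X n.down
  let ι : ∀ n, X n ⟶ ∐ F := fun n => Sigma.ι F ⟨n⟩
  -- The telescope: `s` moves the `n`-th summand to the next one by `φ n`, and the homotopy colimit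
  -- is the cone of `1 - s`.
  let s : ∐ F ⟶ ∐ F := Sigma.desc fun n => φ n.down ≫ ι (n.down + 1)
  have hs (n : ℕ) : ι n ≫ s = φ n ≫ ι (n + 1) := Sigma.ι_desc _ _
  obtain ⟨Y, π, δ, hΔ⟩ := distinguished_cocone_triangle (𝟙 _ - s)
  have hsπ : s ≫ π = π := by
    have : (𝟙 _ - s) ≫ π = 0 := distTriang_comp₁₂ hΔ
    rwa [Preadditive.sub_comp, Category.id_comp, sub_eq_zero, eq_comm] at this
  have hψ (n : ℕ) : φ n ≫ ι (n + 1) ≫ π = ι n ≫ π := by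
    rw [← Category.assoc, ← hs, Category.assoc, hsπ]
  obtain ⟨z, hz⟩ := H.exists_sigma F fun n => x n.down
  have hz' (n : ℕ) : H.map (ι n) z = x n := hz ⟨n⟩
  obtain ⟨y, hy⟩ := H.exact hΔ z (H.sigma_ext F _ fun n => by
    change H.map (ι n.down) _ = 0
    rw [← H.map_comp, Preadditive.comp_sub, Category.comp_id, hs, H.map_sub, H.map_comp, hz', hz',
      hx, sub_self])
  refine ⟨Y, y, fun n => ι n ≫ π, hψ, fun n => ?_, fun h => ?_, fun G hG f => ?_⟩
  · rw [H.map_comp, hy, hz']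
  · have : P (∐ F) := hP _ _ fun n => h n.down
    exact P.ext_of_isTriangulatedClosed₃ _ hΔ this this
  · have trans (n m : ℕ) (hnm : n ≤ m) (g : G ⟶ X n) :
        ∃ g' : G ⟶ X m, g' ≫ ι m ≫ π = g ≫ ι n ≫ π := by
      induction m, hnm using Nat.le_induction with
      | base => exact ⟨g, rfl⟩
      | succ m _ ih =>
        obtain ⟨g', hg'⟩ := ih
        exact ⟨g' ≫ φ m, by rw [Category.assoc, hψ, hg']⟩
    have hδ : f ≫ δ = 0 := by
      refine eq_zero_of_comp_shift_eq_zero (α := 𝟙 _ - s) (fun u hu => ?_) ?_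
      -- A map `u` from a compact object with `u ≫ (1 - s) = 0` satisfies `u = u ≫ s`. As `s` raises
      -- the index, the component of `u` at `0` vanishes, and then all the others do by induction.
      -- Compactness turns vanishing components into `u = 0`.
      · let p (n : ℕ) : ∐ F ⟶ F ⟨n⟩ :=
          Sigma.desc (fun j => if h : j = ⟨n⟩ then eqToHom (by rw [h]) else 0)
        have hu' : u ≫ s = u := by
          rwa [Preadditive.comp_sub, Category.comp_id, sub_eq_zero, eq_comm] at hu
        have hs0 : s ≫ p 0 = 0 := Sigma.hom_ext _ _ fun n => by
          change ι n.down ≫ _ = _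
          rw [← Category.assoc, hs, Category.assoc, comp_zero]
          simp [ι, p]
        have hs1 (n : ℕ) : s ≫ p (n + 1) = p n ≫ φ n := Sigma.hom_ext _ _ fun ⟨m⟩ => by
          change ι m ≫ _ = ι m ≫ _
          rw [← Category.assoc, hs, Category.assoc]
          by_cases h : m = n
          · subst h; simp [ι, p, F]
          · simp [ι, p, h]
        have hp (n : ℕ) : u ≫ p n = 0 := by
          induction n with
          | zero => rw [← hu', Category.assoc, hs0, comp_zero]
          | succ n ih => rw [← hu', Category.assoc, hs1, ← Category.assoc, ih, zero_comp]
        obtain ⟨a, rfl⟩ := sumToSigma_surjective (compacts_shift hG (-1)) F u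
        have : a = 0 := DFinsupp.ext fun n => by
          rw [← sumToSigma_comp_desc]
          exact hp n.down
        rw [this, map_zero]
      · rw [Category.assoc, distTriang_comp₃₁ hΔ, comp_zero]
    obtain ⟨g, hg⟩ := distTriang_lift₃ hΔ f hδ
    obtain ⟨a, rfl⟩ := sumToSigma_surjective hG F g
    subst hg
    induction a using DirectSum.induction_on with
    | zero => exact ⟨0, 0, by simp⟩
    | of n a => exact ⟨n.down, a, by rw [sumToSigma_of, Category.assoc]⟩
    | add a b ha hb =>
      obtain ⟨n, f, hf⟩ := ha (by rw [Category.assoc, distTriang_comp₂₃ hΔ, comp_zero])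
      obtain ⟨m, g, hg⟩ := hb (by rw [Category.assoc, distTriang_comp₂₃ hΔ, comp_zero])
      obtain ⟨f', hf'⟩ := trans n (max n m) (le_max_left _ _) f
      obtain ⟨g', hg'⟩ := trans m (max n m) (le_max_right _ _) g
      exact ⟨max n m, f' + g', by
        rw [Preadditive.add_comp, hf', hg', hf, hg, _root_.map_add, Preadditive.add_comp]⟩

/-- Any element of a cohomological functor extends to one which is universal with respect to
morphisms from a given family of compact objects. -/
lemma exists_bijective [∀ i, Small.{v} (H.obj (G i))] (hG : ∀ i, compacts T (G i))
    [P.IsTriangulated] [P.IsClosedUnderIsomorphisms] (hPG : ∀ i, P (G i))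
    (hP : ∀ (J : Type v) (X : J → T), (∀ j, P (X j)) → P (∐ X)) (X : T) (x : H.obj X) :
    ∃ (Y : T) (y : H.obj Y) (φ : X ⟶ Y), H.map φ y = x ∧ (P X → P Y) ∧
      ∀ i, Function.Bijective fun f : G i ⟶ Y => H.map f y := by
  obtain ⟨X₀, x₀, φ₀, hx₀, hPX₀, hsurj⟩ := H.exists_surjective hPG hP X x
  choose K k κ hk hPK hκ using fun e : Σ X : T, H.obj X => H.exists_kill hPG hP e.1 e.2
  let E : ℕ → Σ X : T, H.obj X := fun n => (fun e => ⟨K e, k e⟩)^[n] ⟨X₀, x₀⟩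
  have hE (n : ℕ) : E (n + 1) = ⟨K (E n), k (E n)⟩ := Function.iterate_succ_apply' _ _ _
  have step (n : ℕ) : ∃ ψ : (E n).1 ⟶ (E (n + 1)).1, H.map ψ (E (n + 1)).2 = (E n).2 ∧
      (P (E n).1 → P (E (n + 1)).1) ∧
      ∀ i (f : G i ⟶ (E n).1), H.map f (E n).2 = 0 → f ≫ ψ = 0 := by
    rw [hE]
    exact ⟨κ (E n), hk _, hPK _, hκ _⟩
  choose ψ hψ hPψ hψ' using step
  obtain ⟨Y, y, θ, hθ, hy, hPY, hc⟩ :=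
    H.exists_hocolim hP (fun n => (E n).1) ψ (fun n => (E n).2) hψ
  obtain ⟨θ₀, hθ₀⟩ : ∃ θ₀ : X₀ ⟶ Y, H.map θ₀ y = x₀ := ⟨θ 0, hy 0⟩
  refine ⟨Y, y, φ₀ ≫ θ₀, ?_, fun hX => hPY fun n => ?_, fun i => ⟨fun f g hfg => ?_, fun z => ?_⟩⟩
  · rw [H.map_comp, hθ₀, hx₀]
  · induction n with
    | zero => exact hPX₀ hX
    | succ n ih => exact hPψ n ih
  -- A difference killed by `H` already lives at a finite stage, and the next stage annihilates it.
  · rw [← sub_eq_zero]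
    obtain ⟨n, h, hh⟩ := hc _ (hG i) (f - g)
    have h0 : H.map h (E n).2 = 0 := by
      rw [← hy, ← H.map_comp, hh, H.map_sub, sub_eq_zero]
      exact hfg
    rw [← hh, ← hθ, ← Category.assoc, hψ' n i h h0, zero_comp]
  · obtain ⟨f, hf⟩ := hsurj i z
    exact ⟨f ≫ θ₀, by dsimp only; rw [H.map_comp, hθ₀, hf]⟩

end

variable {I : Type v} {G : I → T}

lemma isIso_of_bijective (hG : IsCompactGenerating G) {X Y : T} {x : H.obj X} {y : H.obj Y}
    (φ : X ⟶ Y) (hφ : H.map φ y = x) (hx : ∀ i, Function.Bijective fun f : G i ⟶ X => H.map f x)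
    (hy : ∀ i, Function.Bijective fun f : G i ⟶ Y => H.map f y) : IsIso φ := by
  refine hG.isIso φ fun i => ?_
  rw [← Function.Bijective.of_comp_iff' (hy i)]
  convert hx i using 2 with f
  simp [H.map_comp, hφ]

/-- **Brown representability** for compactly generated triangulated categories. -/
theorem exists_representation [HasCoproducts.{v} T] [∀ i, Small.{v} (H.obj (G i))]
    (hG : IsCompactGenerating G) :
    ∃ (E : T) (x : H.obj E), ∀ A : T, Function.Bijective fun f : A ⟶ E => H.map f x := by
  have : (⊤ : ObjectProperty T).IsTriangulated :=
    { exists_zero := open ZeroObject in ⟨0, isZero_zero T, trivial⟩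
      isStableUnderShiftBy := fun _ => ⟨fun _ _ => trivial⟩
      ext₂' := fun Δ _ _ _ => ⟨Δ.obj₂, trivial, ⟨Iso.refl _⟩⟩ }
  have key (X : T) (x : H.obj X) := H.exists_bijective (P := ⊤) hG.compact (fun _ => trivial)
    (fun _ _ _ => trivial) X x
  obtain ⟨E, x, -, -, -, hx⟩ := key (∐ fun e : PEmpty.{v + 1} => e.elim) 0
  refine ⟨E, x, fun A => ⟨fun f g hfg => ?_, fun a => ?_⟩⟩
  -- If `f - g` kills `x`, then `x` extends to the cone of `f - g`, and from there to a universal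
  -- `Y`. The composite `E ⟶ Y` is an isomorphism that annihilates `f - g`.
  · have h0 : H.map (f - g) x = 0 := by rw [H.map_sub, sub_eq_zero]; exact hfg
    obtain ⟨C, β, δ, hΔ⟩ := distinguished_cocone_triangle (f - g)
    obtain ⟨c, hc⟩ := H.exact hΔ x h0
    obtain ⟨Y, y, φ, hφ, -, hy⟩ := key C c
    have := H.isIso_of_bijective hG (x := x) (y := y) (β ≫ φ) (by rw [H.map_comp, hφ, hc]) hx hy
    rw [← sub_eq_zero, ← cancel_mono (β ≫ φ), ← Category.assoc, distTriang_comp₁₂ hΔ, zero_comp,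
      zero_comp]
  -- Glue `x` and `a` on the coproduct of `E` and `A` and enlarge it to a universal `Y`. Since `E ⟶
  -- Y` is invertible, `a` is pulled back from `x`.
  · let F : ULift.{v} Bool → T := fun b => bif b.down then E else A
    obtain ⟨z, hz⟩ := H.exists_sigma F fun b => match b with
      | ⟨true⟩ => x
      | ⟨false⟩ => a
    obtain ⟨Y, y, φ, hφ, -, hy⟩ := key (∐ F) z
    let α : E ⟶ Y := Sigma.ι F ⟨true⟩ ≫ φ
    have hα : H.map α y = x := (H.map_comp _ _ _).trans (by rw [hφ]; exact hz ⟨true⟩)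
    have := H.isIso_of_bijective hG α hα hx hy
    let γ : A ⟶ Y := Sigma.ι F ⟨false⟩ ≫ φ
    have hγ : H.map γ y = a := (H.map_comp _ _ _).trans (by rw [hφ]; exact hz ⟨false⟩)
    refine ⟨γ ≫ inv α, ?_⟩
    dsimp only
    rw [← hα, ← H.map_comp, Category.assoc, IsIso.inv_hom_id, Category.comp_id, hγ]

end CohFunctor

/-- A triangulated subcategory closed under coproducts which contains a generating family is
everything. -/
theorem IsCompactGenerating.prop [HasCoproducts.{v} T] {I : Type v} {G : I → T}
    (hG : IsCompactGenerating G) (P : ObjectProperty T) [P.IsTriangulated]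
    [P.IsClosedUnderIsomorphisms] (hPG : ∀ i, P (G i))
    (hP : ∀ (J : Type v) (X : J → T), (∀ j, P (X j)) → P (∐ X)) (W : T) : P W := by
  -- For the functor `Hom(-, W)`, the universal element is a map `Y ⟶ W` that is bijective on
  -- generators, with `Y` built inside `P` from the empty coproduct.
  have (i : I) : Small.{v} ((CohFunctor.hom W).obj (G i)) := inferInstanceAs (Small.{v} (G i ⟶ W))
  obtain ⟨Y, y, -, -, hY, hy⟩ := (CohFunctor.hom W).exists_bijective hG.compact hPG hP
    (∐ fun e : PEmpty.{v + 1} => e.elim) 0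
  have : IsIso (show Y ⟶ W from y) := hG.isIso _ hy
  exact P.prop_of_iso (asIso (show Y ⟶ W from y)) (hY (hP _ _ fun e => e.elim))

end Brown
-- Factoring maps out of compact objects
section Factor

variable {T : Type u} [Category.{v} T] [Preadditive T] (P : ObjectProperty T)

/-- The objects `Y` such that every morphism from a compact object to `Y` factors through an
object satisfying `P`. -/
def compactFactor : ObjectProperty T := fun Y =>
  ∀ G : T, compacts T G → ∀ f : G ⟶ Y, ∃ (Z : T) (a : G ⟶ Z) (b : Z ⟶ Y), P Z ∧ a ≫ b = f

variable {P}

lemma le_compactFactor : P ≤ compactFactor P := fun Y hY _ _ f => ⟨Y, f, 𝟙 Y, hY, by simp⟩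

instance : (compactFactor P).IsClosedUnderIsomorphisms where
  of_iso e h G hG f := by
    obtain ⟨Z, a, b, hZ, hab⟩ := h G hG (f ≫ e.inv)
    exact ⟨Z, a, b ≫ e.hom, hZ, by rw [← Category.assoc, hab]; simp⟩

variable [HasZeroObject T] [HasShift T ℤ] [∀ n : ℤ, (shiftFunctor T n).Additive]
  [Pretriangulated T] [P.IsTriangulated] [P.IsClosedUnderIsomorphisms]

lemma exists_factor_add {G Y Z Z' : T} {a : G ⟶ Z} {b : Z ⟶ Y} {a' : G ⟶ Z'} {b' : Z' ⟶ Y}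
    (hZ : P Z) (hZ' : P Z') :
    ∃ (W : T) (c : G ⟶ W) (d : W ⟶ Y), P W ∧ c ≫ d = a ≫ b + a' ≫ b' :=
  ⟨Z ⊞ Z', biprod.lift a a', biprod.desc b b',
    P.ext_of_isTriangulatedClosed₂ _ (binaryBiproductTriangle_distinguished Z Z') hZ hZ',
    biprod.lift_desc⟩

lemma compactFactor_sigma (J : Type v) (X : J → T) [HasCoproduct X]
    (hX : ∀ j, compactFactor P (X j)) : compactFactor P (∐ X) := by
  classical
  intro G hG f
  obtain ⟨x, rfl⟩ := sumToSigma_surjective hG X f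
  induction x using DirectSum.induction_on with
  | zero =>
    obtain ⟨Z, -, hZ⟩ := P.exists_prop_of_containsZero
    exact ⟨Z, 0, 0, hZ, by simp⟩
  | of j x =>
    obtain ⟨Z, a, b, hZ, rfl⟩ := hX j G hG x
    exact ⟨Z, a, b ≫ Sigma.ι X j, hZ, by rw [sumToSigma_of, Category.assoc]⟩
  | add x y hx hy =>
    obtain ⟨Z, a, b, hZ, h⟩ := hx
    obtain ⟨Z', a', b', hZ', h'⟩ := hy
    rw [map_add, ← h, ← h']
    exact exists_factor_add hZ hZ'

/-- Neeman's argument. Factor `f ≫ v` through `P₃`. The fibre `K` of `G ⟶ P₃` is again compact,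
because `P₃` is, so the induced map `K ⟶ Y₁` factors through some `P₁`. Splicing gives an extension
`P₂` of `P₃` by `P₁` with maps `G ⟶ P₂ ⟶ Y₂`. Their composite agrees with `f` after `v`, so the
error comes from a map `G ⟶ Y₁`, which factors through a further `P₁'`. -/
lemma compactFactor_ext [HasCoproducts.{v} T] (hP : P ≤ compacts T) {Y₁ Y₂ Y₃ : T} {u : Y₁ ⟶ Y₂}
    {v : Y₂ ⟶ Y₃} {w : Y₃ ⟶ Y₁⟦(1 : ℤ)⟧} (hY : Triangle.mk u v w ∈ distTriang T)
    (h₁ : compactFactor P Y₁) (h₃ : compactFactor P Y₃) : compactFactor P Y₂ := by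
  intro G hG f
  have := compacts_isTriangulated (T := T)
  obtain ⟨P₃, a₃, b₃, hP₃, h₃⟩ := h₃ G hG (f ≫ v)
  obtain ⟨K, m, n, hK⟩ := distinguished_cocone_triangle₁ a₃
  obtain ⟨x, hx, hx'⟩ := distTriang_complete₁ hK hY f b₃ h₃
  obtain ⟨P₁, a₁, b₁, hP₁, rfl⟩ := h₁ K
    ((compacts T).ext_of_isTriangulatedClosed₁ _ hK hG (hP _ hP₃)) x
  obtain ⟨P₂, p, q, hPP⟩ := distinguished_cocone_triangle₂ (n ≫ a₁⟦(1 : ℤ)⟧')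
  obtain ⟨y, hy, hy'⟩ := distTriang_complete₂ hK hPP a₁ (𝟙 P₃) (by simp)
  obtain ⟨z, hz, hz'⟩ := distTriang_complete₂ hPP hY b₁ b₃ (by simpa using hx')
  obtain ⟨g, hg⟩ := distTriang_lift₂ hY (f - y ≫ z) (by
    rw [Preadditive.sub_comp, ← h₃, Category.assoc, ← hz', ← Category.assoc, ← hy',
      Category.comp_id, sub_self])
  obtain ⟨P₁', a₁', b₁', hP₁', rfl⟩ := h₁ G hG g
  rw [← sub_add_cancel f (y ≫ z), ← hg, Category.assoc]
  exact exists_factor_add hP₁' (P.ext_of_isTriangulatedClosed₂ _ hPP hP₁ hP₃)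

lemma compactFactor_isTriangulated [HasCoproducts.{v} T] (hP : P ≤ compacts T) :
    (compactFactor P).IsTriangulated where
  exists_zero := by
    obtain ⟨Z, hZ, hZ'⟩ := P.exists_prop_of_containsZero
    exact ⟨Z, hZ, le_compactFactor _ hZ'⟩
  isStableUnderShiftBy n := ⟨fun Y hY G hG f => by
    obtain ⟨g, hg⟩ := exists_unshift n f
    obtain ⟨Z, a, b, hZ, rfl⟩ := hY _ (compacts_shift hG (-n)) g
    refine ⟨Z⟦n⟧, (shiftNegShift G n).inv ≫ a⟦n⟧', b⟦n⟧', P.le_shift n _ hZ, ?_⟩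
    rw [Category.assoc, ← Functor.map_comp, ← hg, Iso.inv_hom_id_assoc]⟩
  toIsTriangulatedClosed₂ := .mk' fun _ hΔ h₁ h₃ => compactFactor_ext hP hΔ h₁ h₃

end Factor
-- Linear algebra of dual spaces
section LinearAlgebra

/-- The universe of `k` is arbitrary, but a nonzero `V` contains a copy of `k`, so `k` is small as
soon as the dual is nontrivial. -/
lemma small_dual (k : Type w) [Field k] (V : Type v) [AddCommGroup V] [Module k V] :
    Small.{v} (Module.Dual k V) := by
  by_cases h : Subsingleton V
  · have : Subsingleton (Module.Dual k V) :=
      ⟨fun a b => LinearMap.ext fun x => by rw [Subsingleton.elim x 0, map_zero, map_zero]⟩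
    infer_instance
  · have := not_subsingleton_iff_nontrivial.1 h
    obtain ⟨x, hx⟩ := exists_ne (0 : V)
    have : Small.{v} k := small_of_injective (smul_left_injective k hx)
    exact small_of_injective (DFunLike.coe_injective (F := Module.Dual k V))

lemma exists_dual_comp_eq {k : Type w} [Field k] {V W : Type*} [AddCommGroup V] [Module k V]
    [AddCommGroup W] [Module k W] (L : V →ₗ[k] W) (φ : Module.Dual k V)
    (h : ∀ x, L x = 0 → φ x = 0) : ∃ ψ : Module.Dual k W, ∀ x, ψ (L x) = φ x := by
  have : φ ∈ LinearMap.range L.dualMap := by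
    rw [LinearMap.range_dualMap_eq_dualAnnihilator_ker, Submodule.mem_dualAnnihilator]
    exact fun x hx => h x hx
  obtain ⟨ψ, rfl⟩ := this
  exact ⟨ψ, fun x => rfl⟩

end LinearAlgebra

/-! ### Duality through trace forms, and transposes -/

section Trace

variable {T : Type u} [Category.{v} T] [Preadditive T] {k : Type w} [Field k] [Linear k T]

/-- A linear form `t` on `Hom(G, E)` is a trace if the pairings
`Hom(G, X) × Hom(X, E) → k`, `(h, f) ↦ t (h ≫ f)` identify `Hom(X, E)` with the dual of
`Hom(G, X)`. -/
structure IsTrace {G E : T} (t : Module.Dual k (G ⟶ E)) : Prop where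
  eq_zero : ∀ {X : T} (f : X ⟶ E), (∀ h : G ⟶ X, t (h ≫ f) = 0) → f = 0
  exists_hom : ∀ {X : T} (φ : Module.Dual k (G ⟶ X)), ∃ f : X ⟶ E, ∀ h, t (h ≫ f) = φ h

/-- Yoneda: the trace is the image of `𝟙 E` under the isomorphism, and it determines the
isomorphism. -/
lemma isBrownComenetzDual_iff {G E : T} :
    IsBrownComenetzDual k G E ↔ ∃ t : Module.Dual k (G ⟶ E), IsTrace t := by
  constructor
  · rintro ⟨e, he⟩
    have key {X : T} (f : X ⟶ E) (h : G ⟶ X) : e E (𝟙 E) (h ≫ f) = e X f h := by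
      rw [← he, Category.comp_id]
    refine ⟨e E (𝟙 E), fun f hf => ?_, fun φ => ⟨(e _).symm φ, fun h => ?_⟩⟩
    · rw [← (e _).map_eq_zero_iff]
      ext h
      rw [← key, hf, LinearMap.zero_apply]
    · rw [key, LinearEquiv.apply_symm_apply]
  · rintro ⟨t, ht⟩
    let L (X : T) : (X ⟶ E) →ₗ[k] Module.Dual k (G ⟶ X) :=
      { toFun := fun f => t ∘ₗ Linear.rightComp k G f
        map_add' := fun f g => by ext h; simp
        map_smul' := fun c f => by ext h; simp }
    refine ⟨fun X => LinearEquiv.ofBijective (L X) ⟨?_, fun φ => ?_⟩, fun X Y f g h => ?_⟩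
    · rw [injective_iff_map_eq_zero]
      exact fun f hf => ht.eq_zero f fun h => congr($hf h)
    · obtain ⟨f, hf⟩ := ht.exists_hom φ
      exact ⟨f, LinearMap.ext hf⟩
    · exact congr(t $((Category.assoc h f g).symm))

lemma IsTrace.of_iso {G E E' : T} {t : Module.Dual k (G ⟶ E)} (ht : IsTrace t) (e : E ≅ E') :
    IsTrace (t ∘ₗ Linear.rightComp k G e.inv) where
  eq_zero f hf := by
    rw [← cancel_mono e.inv, zero_comp]
    exact ht.eq_zero _ fun h => by simpa using hf h
  exists_hom φ := by
    obtain ⟨f, hf⟩ := ht.exists_hom φ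
    exact ⟨f ≫ e.hom, by simpa using hf⟩

instance : (dualsOfCompacts T k).IsClosedUnderIsomorphisms where
  of_iso e := by
    rintro ⟨G, hG, hE⟩
    obtain ⟨t, ht⟩ := isBrownComenetzDual_iff.1 hE
    exact ⟨G, hG, isBrownComenetzDual_iff.2 ⟨_, ht.of_iso e⟩⟩

/-- Morphisms `g : G ⟶ H` and `f : E ⟶ F` which are transposes of each other with respect to
linear forms on `Hom(G, E)` and `Hom(H, F)`. -/
def AreTransposed {G E H F : T} (t : Module.Dual k (G ⟶ E)) (s : Module.Dual k (H ⟶ F))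
    (g : G ⟶ H) (f : E ⟶ F) : Prop :=
  ∀ h : H ⟶ E, s (h ≫ f) = t (g ≫ h)

section

variable {G E H F : T} {t : Module.Dual k (G ⟶ E)} {s : Module.Dual k (H ⟶ F)}

lemma AreTransposed.id (t : Module.Dual k (G ⟶ E)) : AreTransposed t t (𝟙 G) (𝟙 E) :=
  fun h => by simp

lemma AreTransposed.comp {K D : T} {r : Module.Dual k (K ⟶ D)} {g : G ⟶ H} {f : E ⟶ F}
    {g' : H ⟶ K} {f' : F ⟶ D} (h : AreTransposed t s g f) (h' : AreTransposed s r g' f') :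
    AreTransposed t r (g ≫ g') (f ≫ f') := fun x => by
  rw [← Category.assoc, h', ← Category.assoc, h, Category.assoc]

lemma exists_areTransposed_right (hs : IsTrace s) (t : Module.Dual k (G ⟶ E)) (g : G ⟶ H) :
    ∃ f : E ⟶ F, AreTransposed t s g f :=
  hs.exists_hom (t ∘ₗ Linear.leftComp k E g)

lemma AreTransposed.right_unique (hs : IsTrace s) {g : G ⟶ H} {f f' : E ⟶ F}
    (h : AreTransposed t s g f) (h' : AreTransposed t s g f') : f = f' := by
  rw [← sub_eq_zero]
  refine hs.eq_zero _ fun x => ?_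
  rw [Preadditive.comp_sub, map_sub, h, h', sub_self]

/-- Because `t` is a trace, `h ↦ s (h ≫ f)` extends to a linear form on the dual of `Hom(G, H)`.
Finite-dimensionality makes that form evaluation at some `g`. -/
lemma exists_areTransposed_left (ht : IsTrace t) [Module.Finite k (G ⟶ H)]
    (s : Module.Dual k (H ⟶ F)) (f : E ⟶ F) : ∃ g : G ⟶ H, AreTransposed t s g f := by
  let D : (H ⟶ E) →ₗ[k] Module.Dual k (G ⟶ H) :=
    { toFun := fun f => t ∘ₗ Linear.rightComp k G f
      map_add' := fun f g => by ext h; simp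
      map_smul' := fun c f => by ext h; simp }
  obtain ⟨θ, hθ⟩ := exists_dual_comp_eq D (s ∘ₗ Linear.rightComp k H f) fun h hh => by
    rw [ht.eq_zero h fun x => congr($hh x), map_zero]
  obtain ⟨g, rfl⟩ := (Module.evalEquiv k (G ⟶ H)).surjective θ
  exact ⟨g, fun h => (hθ h).symm⟩

/-- The forms `t (- ≫ x)` exhaust the dual of `Hom(G, H)`, so they separate its points. -/
lemma AreTransposed.left_unique (ht : IsTrace t) {g g' : G ⟶ H} {f : E ⟶ F}
    (h : AreTransposed t s g f) (h' : AreTransposed t s g' f) : g = g' := by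
  rw [← sub_eq_zero, ← Module.forall_dual_apply_eq_zero_iff k]
  intro φ
  obtain ⟨x, hx⟩ := ht.exists_hom φ
  rw [← hx, Preadditive.sub_comp, map_sub, ← h, ← h', sub_self]

end

end Trace

/-! ### Exactness of duality and existence of duals -/

section Triangulated

variable {T : Type u} [Category.{v} T] [Preadditive T] [HasShift T ℤ]
  [∀ n : ℤ, (shiftFunctor T n).Additive] {k : Type w} [Field k] [Linear k T]
  [∀ n : ℤ, (shiftFunctor T n).Linear k]

/-- The linear form on `Hom(G⟦n⟧, E⟦n⟧)` induced by a linear form on `Hom(G, E)`. -/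
noncomputable def shiftForm {G E : T} (t : Module.Dual k (G ⟶ E)) (n : ℤ) :
    Module.Dual k (G⟦n⟧ ⟶ E⟦n⟧) :=
  t ∘ₗ (LinearEquiv.ofBijective ((shiftFunctor T n).mapLinearMap k)
    ⟨(shiftFunctor T n).map_injective, (shiftFunctor T n).map_surjective⟩).symm.toLinearMap

@[simp]
lemma shiftForm_map {G E : T} (t : Module.Dual k (G ⟶ E)) (n : ℤ) (h : G ⟶ E) :
    shiftForm t n (h⟦n⟧') = t h :=
  congr(t $((LinearEquiv.ofBijective ((shiftFunctor T n).mapLinearMap k)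
    ⟨(shiftFunctor T n).map_injective, (shiftFunctor T n).map_surjective⟩).symm_apply_apply h))

lemma IsTrace.shift {G E : T} {t : Module.Dual k (G ⟶ E)} (ht : IsTrace t) (n : ℤ) :
    IsTrace (shiftForm t n) where
  eq_zero {X} f hf := by
    obtain ⟨g, hg⟩ := exists_unshift n f
    have : g = 0 := ht.eq_zero _ fun h => by
      rw [← shiftForm_map t n, Functor.map_comp, ← hg, ← Category.assoc, hf]
    rw [← cancel_epi (shiftNegShift X n).hom, hg, this, Functor.map_zero, comp_zero]
  exists_hom {X} φ := by
    obtain ⟨g, hg⟩ := ht.exists_hom (φ ∘ₗ Linear.rightComp k _ (shiftNegShift X n).hom ∘ₗ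
      (shiftFunctor T n).mapLinearMap k)
    refine ⟨(shiftNegShift X n).inv ≫ g⟦n⟧', fun h => ?_⟩
    obtain ⟨h', hh'⟩ := (shiftFunctor T n).map_surjective (h ≫ (shiftNegShift X n).inv)
    rw [← Category.assoc, ← hh', ← Functor.map_comp, shiftForm_map, hg]
    exact congr(φ $((Iso.comp_inv_eq _).1 hh'.symm)).symm

lemma AreTransposed.shift {G E H F : T} {t : Module.Dual k (G ⟶ E)} {s : Module.Dual k (H ⟶ F)}
    {g : G ⟶ H} {f : E ⟶ F} (h : AreTransposed t s g f) (n : ℤ) :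
    AreTransposed (shiftForm t n) (shiftForm s n) (g⟦n⟧') (f⟦n⟧') := fun x => by
  obtain ⟨x, rfl⟩ := (shiftFunctor T n).map_surjective x
  rw [← Functor.map_comp, ← Functor.map_comp, shiftForm_map, shiftForm_map, h]

variable [HasZeroObject T] [Pretriangulated T]

/-- Brown–Comenetz duality is exact: the cone of the transpose of `g` is dual to the cone
of `g`. -/
lemma exists_isTrace_cone {A B C E F Q : T} {s : Module.Dual k (A ⟶ E)}
    {t : Module.Dual k (B ⟶ F)} (hs : IsTrace s) (ht : IsTrace t)
    {g : A ⟶ B} {h : B ⟶ C} {δ : C ⟶ A⟦(1 : ℤ)⟧} (hC : Triangle.mk g h δ ∈ distTriang T)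
    {f : E ⟶ F} {p : F ⟶ Q} {q : Q ⟶ E⟦(1 : ℤ)⟧} (hQ : Triangle.mk f p q ∈ distTriang T)
    (hgf : AreTransposed s t g f) : ∃ r : Module.Dual k (C ⟶ Q), IsTrace r := by
  have hC' : Triangle.mk h δ (-g⟦(1 : ℤ)⟧') ∈ distTriang T := rot_of_distTriang _ hC
  -- The form `r` is prescribed on maps `u ≫ p` by `t` and on maps `δ ≫ v` by `s`, with a sign. The
  -- two prescriptions agree on overlaps: if `u ≫ p = δ ≫ v`, complete to a morphism of triangles
  -- and use that `g` and `f` are transposes.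
  obtain ⟨r, hr⟩ := exists_dual_comp_eq
    ((Linear.rightComp k C p).coprod (-Linear.leftComp k Q δ))
    ((t ∘ₗ Linear.leftComp k F h).coprod (shiftForm s 1 ∘ₗ Linear.rightComp k _ q)) (by
      rintro ⟨u, v⟩ huv
      have huv' : u ≫ p = δ ≫ v := by simpa [← sub_eq_add_neg, sub_eq_zero] using huv
      obtain ⟨x, hx, hx'⟩ := distTriang_complete₁ hC' hQ u v huv'.symm
      have h1 : v ≫ q = -(g ≫ x)⟦(1 : ℤ)⟧' := by rw [← hx', Functor.map_comp]; simp
      simp only [LinearMap.coprod_apply, LinearMap.comp_apply, Linear.leftComp_apply,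
        Linear.rightComp_apply]
      rw [hx, h1, map_neg, shiftForm_map, hgf, add_neg_cancel])
  have hr₁ (u : C ⟶ F) : r (u ≫ p) = t (h ≫ u) := by simpa using hr (u, 0)
  have hr₂ (v : A⟦(1 : ℤ)⟧ ⟶ Q) : r (δ ≫ v) = -shiftForm s 1 (v ≫ q) := by
    rw [← neg_eq_iff_eq_neg]
    simpa using hr (0, v)
  refine ⟨r, fun {X} m hm => ?_, fun {X} φ => ?_⟩
  -- Injectivity half of a five lemma: `m` comes from some `n : X ⟶ F`, and the form represented by
  -- `n` descends along `g`, so `n` factors through `f`.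
  · have hmq : m ≫ q = 0 := (hs.shift 1).eq_zero _ fun v => by
      rw [← Category.assoc, ← neg_eq_zero, ← hr₂, ← Category.assoc, hm]
    obtain ⟨n, rfl⟩ := distTriang_lift₃ hQ m hmq
    obtain ⟨ψ, hψ⟩ := exists_dual_comp_eq (Linear.leftComp k X g) (t ∘ₗ Linear.rightComp k B n)
      fun y hy => by
        obtain ⟨z, rfl⟩ := distTriang_desc₂ hC y hy
        simpa [← hr₁] using hm z
    obtain ⟨n', hn'⟩ := hs.exists_hom ψ
    have : n = n' ≫ f := by
      rw [← sub_eq_zero]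
      refine ht.eq_zero _ fun y => ?_
      have h1 := hψ y
      rw [← hn'] at h1
      simp only [LinearMap.comp_apply, Linear.leftComp_apply, Linear.rightComp_apply,
        Category.assoc] at h1
      rw [Preadditive.comp_sub, map_sub, ← h1, ← Category.assoc y n' f, hgf, sub_self]
    rw [this, Category.assoc, distTriang_comp₁₂ hQ, comp_zero]
  -- Surjectivity half: first match `φ` on maps factoring through `δ`, then correct `m` by a map
  -- through `F`, since the remaining form factors through restriction along `h`.
  · obtain ⟨q', hq'⟩ := (hs.shift 1).exists_hom (-(φ ∘ₗ Linear.leftComp k X δ))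
    obtain ⟨m, rfl⟩ := distTriang_lift₁ hQ q' ((ht.shift 1).eq_zero _ fun v => by
      rw [← Category.assoc, hgf.shift 1, ← Category.assoc, hq']
      simp [← Category.assoc, distTriang_comp₃₁ hC])
    obtain ⟨ψ, hψ⟩ := exists_dual_comp_eq (Linear.leftComp k X h)
      (φ - r ∘ₗ Linear.rightComp k C m) fun w hw => by
        obtain ⟨v, rfl⟩ := distTriang_desc₃ hC w hw
        have := hq' v
        simp only [LinearMap.sub_apply, LinearMap.comp_apply, Linear.rightComp_apply,
          Category.assoc, LinearMap.neg_apply, Linear.leftComp_apply] at this ⊢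
        rw [hr₂, Category.assoc, this, neg_neg, sub_self]
    obtain ⟨n, hn⟩ := ht.exists_hom ψ
    refine ⟨m + n ≫ p, fun w => ?_⟩
    have := hψ w
    rw [← hn] at this
    simp only [LinearMap.sub_apply, LinearMap.comp_apply, Linear.rightComp_apply,
      Category.assoc, Linear.leftComp_apply] at this
    rw [Preadditive.comp_add, map_add, ← Category.assoc w n p, hr₁, this, add_sub_cancel]

/-- Every map between duals is the transpose of a map of compacts, by finite-dimensionality, so its
cone is the dual of a compact cone. -/
lemma dualsOfCompacts_isTriangulated [HasCoproducts.{v} T] (hT : IsLocallyHomFinite T k) :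
    (dualsOfCompacts T k).IsTriangulated := by
  have := compacts_isTriangulated (T := T)
  have : (dualsOfCompacts T k).IsStableUnderShift ℤ := ⟨fun n => ⟨fun E => by
    rintro ⟨G, hG, hE⟩
    obtain ⟨t, ht⟩ := isBrownComenetzDual_iff.1 hE
    exact ⟨G⟦n⟧, compacts_shift hG n, isBrownComenetzDual_iff.2 ⟨_, ht.shift n⟩⟩⟩⟩
  have : (dualsOfCompacts T k).IsTriangulatedClosed₃ := .mk' (by
    rintro Δ hΔ ⟨A, hA, hE⟩ ⟨B, hB, hF⟩
    obtain ⟨s, hs⟩ := isBrownComenetzDual_iff.1 hE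
    obtain ⟨t, ht⟩ := isBrownComenetzDual_iff.1 hF
    have := hT A B hA hB
    obtain ⟨g, hg⟩ := exists_areTransposed_left hs t Δ.mor₁
    obtain ⟨C, h, δ, hC⟩ := distinguished_cocone_triangle g
    exact ⟨C, (compacts T).ext_of_isTriangulatedClosed₃ _ hC hA hB, isBrownComenetzDual_iff.2
      (exists_isTrace_cone hs ht hC hΔ hg)⟩)
  have := ObjectProperty.IsTriangulatedClosed₂.of_isTriangulatedClosed₃ (P := dualsOfCompacts T k)
  have : (dualsOfCompacts T k).ContainsZero := by
    obtain ⟨Z, hZ, hZ'⟩ := (compacts T).exists_prop_of_containsZero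
    exact ⟨Z, hZ, Z, hZ', isBrownComenetzDual_iff.2 ⟨0, fun f _ => hZ.eq_of_tgt _ _, fun φ =>
      ⟨0, fun h => by rw [hZ.eq_of_src h 0]; simp⟩⟩⟩
  constructor

lemma retractClosure_isTriangulated (P : ObjectProperty T) [P.IsTriangulated]
    [P.IsClosedUnderIsomorphisms] : P.retractClosure.IsTriangulated where
  exists_zero := by
    obtain ⟨Z, hZ, hZ'⟩ := P.exists_prop_of_containsZero
    exact ⟨Z, hZ, P.le_retractClosure _ hZ'⟩
  isStableUnderShiftBy n := ⟨by
    rintro X ⟨Y, hY, ⟨e⟩⟩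
    exact ⟨Y⟦n⟧, P.le_shift n _ hY, ⟨e.map (shiftFunctor T n)⟩⟩⟩
  toIsTriangulatedClosed₂ := .mk' fun Δ hΔ h₁ h₃ =>
    ObjectProperty.monotone_retractClosure
      (ObjectProperty.extensionProduct_le_of_isTriangulatedClosed₂ le_rfl le_rfl) _
      (ObjectProperty.extensionProduct_retractClosure_retractClosure_le P P _
        ⟨_, _, _, _, _, hΔ, h₁, h₃⟩)

lemma dualSubcategory_le_retractClosure [HasCoproducts.{v} T] (hT : IsLocallyHomFinite T k) :
    dualSubcategory T k ≤ (dualsOfCompacts T k).retractClosure := by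
  have := dualsOfCompacts_isTriangulated hT
  have := retractClosure_isTriangulated (dualsOfCompacts T k)
  exact (ObjectProperty.triangEnvelope_le_iff _).2 (dualsOfCompacts T k).le_retractClosure

/-- The functor `X ↦ Hom(G, X)^*` for a compact object `G`. -/
def CohFunctor.dual (k : Type w) [Field k] [Linear k T] {G : T} (hG : compacts T G) :
    CohFunctor.{max v w} T where
  obj X := Module.Dual k (G ⟶ X)
  map f := (Linear.rightComp k G f).dualMap.toAddMonoidHom
  map_id φ := LinearMap.ext fun h => congr(φ $(Category.comp_id h))
  map_comp f g φ := LinearMap.ext fun h => congr(φ $((Category.assoc h f g).symm))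
  map_add f g φ := LinearMap.ext fun h =>
    (congr(φ $(Preadditive.comp_add _ _ _ h f g))).trans (_root_.map_add φ _ _)
  exact {X Y Z a b c} hΔ φ hφ := by
    obtain ⟨ψ, hψ⟩ := exists_dual_comp_eq (Linear.rightComp k G b) φ fun h hh => by
      obtain ⟨h', rfl⟩ := distTriang_lift₂ hΔ h hh
      exact congr($hφ h')
    exact ⟨ψ, LinearMap.ext hψ⟩
  exists_sigma X _ x := by
    obtain ⟨φ, hφ⟩ := exists_addMonoidHom_of_surjective (sumToSigma_surjective hG X)
      fun j => (x j).toAddMonoidHom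
    refine ⟨{ φ with
      map_smul' := fun c f => ?_ }, fun j => LinearMap.ext (hφ j)⟩
    refine DFunLike.congr_fun (sumToSigma_hom_ext (sumToSigma_surjective hG X)
      (φ := φ.comp (DistribSMul.toAddMonoidHom _ c))
      (ψ := (DistribSMul.toAddMonoidHom _ c).comp φ) fun j g => ?_) f
    simp [← Linear.smul_comp, hφ]
  sigma_ext X _ z h := by
    have := sumToSigma_hom_ext (sumToSigma_surjective hG X) (φ := z.toAddMonoidHom) (ψ := 0)
      fun j g => congr($(h j) g)
    exact LinearMap.ext fun f => congr($this f)

/-- Every compact object has a Brown–Comenetz dual. -/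
lemma IsCompactlyGenerated.exists_isTrace (hT : IsCompactlyGenerated T) (k : Type w) [Field k]
    [Linear k T] {G : T} (hG : compacts T G) :
    ∃ (E : T) (t : Module.Dual k (G ⟶ E)), IsTrace t := by
  have := hT.hasCoproducts
  obtain ⟨I, Γ, hΓ⟩ := hT.exists_isCompactGenerating
  have (i : I) : Small.{v} ((CohFunctor.dual k hG).obj (Γ i)) := small_dual k (G ⟶ Γ i)
  obtain ⟨E, t, ht⟩ := (CohFunctor.dual k hG).exists_representation hΓ
  refine ⟨E, t, fun {X} f hf => (ht X).1 ?_, fun {X} φ => ?_⟩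
  · exact LinearMap.ext fun h => (hf h).trans (by
      change 0 = (show Module.Dual k (G ⟶ E) from t) (h ≫ 0)
      rw [comp_zero, map_zero])
  · obtain ⟨f, hf⟩ := (ht X).2 φ
    exact ⟨f, fun h => DFunLike.congr_fun (F := Module.Dual k (G ⟶ X)) hf h⟩

end Triangulated
-- Transport of duality along adjoint triples
section Adjunction

variable {S : Type u₁} [Category.{v} S] [Preadditive S] {T : Type u₂} [Category.{v} T]
  [Preadditive T] {k : Type w} [Field k] [Linear k S] [Linear k T]
  {L : S ⥤ T} {M : T ⥤ S} {N : S ⥤ T} (adj₁ : L ⊣ M) (adj₂ : M ⊣ N)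
  [M.Additive] [M.Linear k]

/-- Given adjunctions `L ⊣ M ⊣ N`, the linear form on `Hom(L G, N E)` induced by a linear form
on `Hom(G, E)`. -/
noncomputable def adjForm {G E : S} (t : Module.Dual k (G ⟶ E)) :
    Module.Dual k (L.obj G ⟶ N.obj E) :=
  t ∘ₗ Linear.leftComp k E (adj₁.unit.app G) ∘ₗ Linear.rightComp k _ (adj₂.counit.app E) ∘ₗ
    M.mapLinearMap k

lemma adjForm_apply {G E : S} (t : Module.Dual k (G ⟶ E)) (h : L.obj G ⟶ N.obj E) :
    adjForm adj₁ adj₂ t h = t (adj₁.unit.app G ≫ M.map h ≫ adj₂.counit.app E) := rfl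

lemma adjForm_comp {G E : S} (t : Module.Dual k (G ⟶ E)) {X : T} (h : L.obj G ⟶ X)
    (f : X ⟶ N.obj E) : adjForm adj₁ adj₂ t (h ≫ f) =
      t (adj₁.homEquiv _ _ h ≫ (adj₂.homEquiv _ _).symm f) := by
  simp [adjForm_apply, Adjunction.homEquiv_unit, Adjunction.homEquiv_counit]

/-- `Hom(X, N E) ≅ Hom(M X, E) ≅ Hom(G, M X)^* ≅ Hom(L G, X)^*`. -/
lemma IsTrace.adjForm [L.Additive] [L.Linear k] {G E : S} {t : Module.Dual k (G ⟶ E)}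
    (ht : IsTrace t) :
    IsTrace (adjForm adj₁ adj₂ t) where
  eq_zero {X} f hf := by
    have h0 : (adj₂.homAddEquiv X E).symm f = 0 := ht.eq_zero _ fun h => by
      have := hf ((adj₁.homEquiv _ _).symm h)
      rwa [adjForm_comp, Equiv.apply_symm_apply] at this
    rwa [AddEquiv.map_eq_zero_iff] at h0
  exists_hom {X} φ := by
    obtain ⟨f, hf⟩ := ht.exists_hom (φ ∘ₗ Linear.rightComp k _ (adj₁.counit.app X) ∘ₗ
      L.mapLinearMap k)
    refine ⟨adj₂.homEquiv _ _ f, fun h => ?_⟩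
    rw [adjForm_comp, Equiv.symm_apply_apply, hf]
    exact congr(φ $((adj₁.homEquiv_counit _ _ _).symm.trans
      ((adj₁.homEquiv _ _).symm_apply_apply h)))

lemma AreTransposed.adjForm {G E H F : S} {t : Module.Dual k (G ⟶ E)} {s : Module.Dual k (H ⟶ F)}
    {g : G ⟶ H} {f : E ⟶ F} (h : AreTransposed t s g f) :
    AreTransposed (adjForm adj₁ adj₂ t) (adjForm adj₁ adj₂ s) (L.map g) (N.map f) := fun x => by
  rw [adjForm_apply, adjForm_apply]
  have := h (adj₁.unit.app H ≫ M.map x ≫ adj₂.counit.app E)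
  simp only [Functor.map_comp, Category.assoc, Adjunction.counit_naturality] at this ⊢
  rw [this, ← Adjunction.unit_naturality_assoc]

end Adjunction

/-! ### Neeman localization for the compact objects of a recollement -/

section Recollement

variable {k : Type w} [Field k]
  {R : Type u₁} [Category.{v} R] [Preadditive R] [HasZeroObject R] [HasShift R ℤ]
  [∀ n : ℤ, (shiftFunctor R n).Additive] [Pretriangulated R] [Linear k R]
  {T : Type u₂} [Category.{v} T] [Preadditive T] [HasZeroObject T] [HasShift T ℤ]
  [∀ n : ℤ, (shiftFunctor T n).Additive] [Pretriangulated T] [Linear k T]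
  {S : Type u₃} [Category.{v} S] [Preadditive S] [HasZeroObject S] [HasShift S ℤ]
  [∀ n : ℤ, (shiftFunctor S n).Additive] [Pretriangulated S] [Linear k S]

namespace Recollement

variable (r : Recollement k R T S)

lemma isZero_jUpper_iLower (Y : R) : IsZero (r.jUpper.obj (r.iLower.obj Y)) := by
  rw [IsZero.iff_id_eq_zero]
  apply (r.jAdjRight.homEquiv _ _).injective
  apply (r.iAdjRight.homEquiv _ _).injective
  exact (r.isZero_iUpperShriek_jLowerStar _).eq_of_tgt _ _

lemma isZero_iUpperStar_jLowerShriek (W : S) :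
    IsZero (r.iUpperStar.obj (r.jLowerShriek.obj W)) := by
  rw [IsZero.iff_id_eq_zero]
  apply (r.iAdjLeft.homEquiv _ _).injective
  apply (r.jAdjLeft.homEquiv _ _).injective
  exact (r.isZero_jUpper_iLower _).eq_of_tgt _ _

lemma compacts_jLowerShriek {G : S} (hG : compacts S G) : compacts T (r.jLowerShriek.obj G) := by
  have := r.jAdjRight.leftAdjoint_preservesColimits
  exact compacts_of_adjunction r.jAdjLeft hG

lemma compacts_iUpperStar {G : T} (hG : compacts T G) : compacts R (r.iUpperStar.obj G) := by
  have := r.iAdjRight.leftAdjoint_preservesColimits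
  exact compacts_of_adjunction r.iAdjLeft hG

lemma dualsOfCompacts_jLowerStar {E : S} (hE : dualsOfCompacts S k E) :
    dualsOfCompacts T k (r.jLowerStar.obj E) := by
  obtain ⟨G, hG, hE⟩ := hE
  obtain ⟨t, ht⟩ := isBrownComenetzDual_iff.1 hE
  exact ⟨_, r.compacts_jLowerShriek hG,
    isBrownComenetzDual_iff.2 ⟨_, ht.adjForm r.jAdjLeft r.jAdjRight⟩⟩

lemma dualsOfCompacts_iUpperShriek {E : T} (hE : dualsOfCompacts T k E) :
    dualsOfCompacts R k (r.iUpperShriek.obj E) := by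
  obtain ⟨G, hG, hE⟩ := hE
  obtain ⟨t, ht⟩ := isBrownComenetzDual_iff.1 hE
  exact ⟨_, r.compacts_iUpperStar hG,
    isBrownComenetzDual_iff.2 ⟨_, ht.adjForm r.iAdjLeft r.iAdjRight⟩⟩

end Recollement

lemma dualSubcategory_map [IsTriangulated T] {F : S ⥤ T} [F.CommShift ℤ] [F.IsTriangulated]
    (hF : ∀ E, dualsOfCompacts S k E → dualsOfCompacts T k (F.obj E)) (E : S)
    (hE : dualSubcategory S k E) : dualSubcategory T k (F.obj E) := by
  have : ((dualSubcategory T k).inverseImage F).IsStableUnderRetracts :=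
    ⟨fun e h => (dualSubcategory T k).prop_of_retract (e.map F) h⟩
  exact (ObjectProperty.triangEnvelope_le_iff (dualsOfCompacts S k)).2
    (show _ ≤ (dualSubcategory T k).inverseImage F from
      fun X hX => ObjectProperty.le_triangEnvelope _ _ (hF X hX)) E hE

namespace Recollement

variable (r : Recollement k R T S)

/-- The image of the compact objects under `j_!`. -/
def compactImage : ObjectProperty T := fun Y =>
  ∃ W : S, compacts S W ∧ Nonempty (r.jLowerShriek.obj W ≅ Y)

lemma compactImage_le : r.compactImage ≤ compacts T := by
  rintro Y ⟨W, hW, ⟨e⟩⟩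
  exact (compacts T).prop_of_iso e (r.compacts_jLowerShriek hW)

instance : r.compactImage.IsClosedUnderIsomorphisms where
  of_iso e := by
    rintro ⟨W, hW, ⟨e'⟩⟩
    exact ⟨W, hW, ⟨e' ≪≫ e⟩⟩

lemma compactImage_isTriangulated [HasCoproducts.{v} S] : r.compactImage.IsTriangulated := by
  have := compacts_isTriangulated (T := S)
  have := r.jLowerShriek_full
  have h : r.compactImage = ((compacts S).ι ⋙ r.jLowerShriek).essImage := by
    ext Y
    exact ⟨fun ⟨W, hW, e⟩ => ⟨⟨W, hW⟩, e⟩, fun ⟨W, e⟩ => ⟨W.obj, W.property, e⟩⟩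
  rw [h]
  infer_instance

/-- The objects `W` with this property form a localizing subcategory of `S`, as `j_!` is
triangulated and preserves coproducts, and they include the compact generators. -/
lemma compactFactor_jLowerShriek [HasCoproducts.{v} T] (hS : IsCompactlyGenerated S) (W : S) :
    compactFactor r.compactImage (r.jLowerShriek.obj W) := by
  have := hS.hasCoproducts
  have := r.compactImage_isTriangulated
  have := compactFactor_isTriangulated r.compactImage_le
  have := r.jAdjLeft.leftAdjoint_preservesColimits
  obtain ⟨I, Γ, hΓ⟩ := hS.exists_isCompactGenerating
  refine hΓ.prop ((compactFactor r.compactImage).inverseImage r.jLowerShriek)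
    (fun i => le_compactFactor _ ⟨Γ i, hΓ.compact i, ⟨Iso.refl _⟩⟩) (fun J X hX => ?_) W
  exact (compactFactor r.compactImage).prop_of_iso (PreservesCoproduct.iso r.jLowerShriek X).symm
    (compactFactor_sigma J _ hX)

lemma exists_distTriang (X : T) :
    ∃ (ε : r.jLowerShriek.obj (r.jUpper.obj X) ⟶ X)
      (δ : r.iLower.obj (r.iUpperStar.obj X) ⟶ (r.jLowerShriek.obj (r.jUpper.obj X))⟦(1 : ℤ)⟧),
      Triangle.mk ε (r.iAdjLeft.homEquiv X _ (𝟙 _)) δ ∈ distTriang T := by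
  obtain ⟨δ, hδ⟩ := r.exists_triangle_left X
  rw [Adjunction.homEquiv_id]
  exact ⟨_, δ, hδ⟩

/-- A morphism between compact objects killed by `i^*` factors through a compact object in the
image of `j_!`. -/
lemma exists_factor [HasCoproducts.{v} T] (hS : IsCompactlyGenerated S) {A B : T}
    (hA : compacts T A) (g : A ⟶ B) (hg : r.iUpperStar.map g = 0) :
    ∃ (Z : T) (a : A ⟶ Z) (b : Z ⟶ B), r.compactImage Z ∧ a ≫ b = g := by
  obtain ⟨ε, δ, hδ⟩ := r.exists_distTriang B
  obtain ⟨g', rfl⟩ := distTriang_lift₂ hδ g (by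
    rw [← Adjunction.homEquiv_naturality_left, hg, zero_comp, Adjunction.homEquiv_unit,
      Functor.map_zero, comp_zero])
  obtain ⟨Z, a, b, hZ, rfl⟩ := r.compactFactor_jLowerShriek hS _ A hA g'
  exact ⟨Z, a, b ≫ ε, hZ, by simp⟩

lemma isIso_iUpperStar_map {A B Z : T} {a : A ⟶ B} {b : B ⟶ Z} {c : Z ⟶ A⟦(1 : ℤ)⟧}
    (h : Triangle.mk a b c ∈ distTriang T) (hZ : r.compactImage Z) :
    IsIso (r.iUpperStar.map a) := by
  obtain ⟨W, -, ⟨e⟩⟩ := hZ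
  exact (Triangle.isZero₃_iff_isIso₁ _ (r.iUpperStar.map_distinguished _ h)).1
    ((r.isZero_iUpperStar_jLowerShriek W).of_iso (r.iUpperStar.mapIso e.symm))

/-- A morphism between the images under `i^*` of compact objects is a fraction of morphisms
between compact objects. -/
lemma exists_roof [HasCoproducts.{v} T] (hS : IsCompactlyGenerated S) {A B : T}
    (hA : compacts T A) (ψ : r.iUpperStar.obj A ⟶ r.iUpperStar.obj B) :
    ∃ (B' Z : T) (a : A ⟶ B') (b : B ⟶ B') (p : B' ⟶ Z) (q : Z ⟶ B⟦(1 : ℤ)⟧),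
      Triangle.mk b p q ∈ distTriang T ∧ r.compactImage Z ∧
        r.iUpperStar.map a = ψ ≫ r.iUpperStar.map b := by
  have := hS.hasCoproducts
  have := r.compactImage_isTriangulated
  have := compactFactor_isTriangulated r.compactImage_le
  obtain ⟨ε, δ, hδ⟩ := r.exists_distTriang B
  have hδ' : Triangle.mk (r.iAdjLeft.homEquiv B _ (𝟙 _)) δ (-ε⟦(1 : ℤ)⟧') ∈ distTriang T :=
    rot_of_distTriang _ hδ
  -- The obstruction to lifting the adjoint map `A ⟶ i_* i^* B` to `B` factors through some `Z` in
  -- `j_!` of the compacts. Extending `B` by `Z` gives `B'`, over which the lift `a'` exists up to a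
  -- map `n` into `B`.
  obtain ⟨Z, a₁, b₁, hZ, h₁⟩ := (compactFactor r.compactImage).le_shift (1 : ℤ) _
    (r.compactFactor_jLowerShriek hS (r.jUpper.obj B)) A hA (r.iAdjLeft.homEquiv _ _ ψ ≫ δ)
  obtain ⟨B', b, p, hB'⟩ := distinguished_cocone_triangle₂
    (b₁ ≫ (-ε⟦(1 : ℤ)⟧'))
  obtain ⟨a', rfl⟩ := distTriang_lift₃ hB' a₁ (by
    rw [← Category.assoc, h₁, Category.assoc, distTriang_comp₂₃ hδ', comp_zero])
  obtain ⟨y, hy, hy'⟩ := distTriang_complete₂ hB' hδ' (𝟙 B) b₁ (by simp)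
  obtain ⟨n, hn⟩ := distTriang_lift₂ hδ' (a' ≫ y - r.iAdjLeft.homEquiv _ _ ψ) (by
    rw [Preadditive.sub_comp, ← h₁, Category.assoc, Category.assoc, hy', sub_self])
  have := r.isIso_iUpperStar_map hB' hZ
  refine ⟨B', Z, a' - n ≫ b, b, p, _, hB', hZ, ?_⟩
  have hb : r.iUpperStar.map b ≫ (r.iAdjLeft.homEquiv _ _).symm y = 𝟙 _ := by
    rw [← Adjunction.homEquiv_naturality_left_symm, hy, Category.id_comp, Equiv.symm_apply_eq]
  have ha : r.iUpperStar.map (a' - n ≫ b) ≫ (r.iAdjLeft.homEquiv _ _).symm y = ψ := by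
    rw [← Adjunction.homEquiv_naturality_left_symm, Equiv.symm_apply_eq, Preadditive.sub_comp,
      Category.assoc, hy, Category.id_comp, hn, sub_sub_cancel]
  rw [← ha, Category.assoc, (IsIso.inv_eq_of_hom_inv_id hb).symm, IsIso.inv_hom_id,
    Category.comp_id]

/-- The image of the compact objects under `i^*`. -/
def compactQuotient : ObjectProperty R := fun Y =>
  ∃ G : T, compacts T G ∧ Nonempty (r.iUpperStar.obj G ≅ Y)

lemma compactQuotient_le : r.compactQuotient ≤ compacts R := by
  rintro Y ⟨G, hG, ⟨e⟩⟩
  exact (compacts R).prop_of_iso e (r.compacts_iUpperStar hG)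

instance : r.compactQuotient.IsClosedUnderIsomorphisms where
  of_iso e := by
    rintro ⟨W, hW, ⟨e'⟩⟩
    exact ⟨W, hW, ⟨e' ≪≫ e⟩⟩

/-- For cones, `exists_roof` replaces a map `i^* A ⟶ i^* B` by the image of a map of compacts `A ⟶
B'` with `i^* B' ≅ i^* B`. -/
lemma compactQuotient_isTriangulated [HasCoproducts.{v} T] (hS : IsCompactlyGenerated S) :
    r.compactQuotient.IsTriangulated := by
  have := compacts_isTriangulated (T := T)
  have : r.compactQuotient.IsStableUnderShift ℤ := ⟨fun n => ⟨by
    rintro Y ⟨G, hG, ⟨e⟩⟩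
    exact ⟨G⟦n⟧, compacts_shift hG n,
      ⟨(r.iUpperStar.commShiftIso n).app G ≪≫ (shiftFunctor R n).mapIso e⟩⟩⟩⟩
  have : r.compactQuotient.IsTriangulatedClosed₃ := .mk' (by
    rintro Δ hΔ ⟨A, hA, ⟨e⟩⟩ ⟨B, hB, ⟨f⟩⟩
    obtain ⟨B', Z, a, b, p, q, hb, hZ, hab⟩ := r.exists_roof hS hA (e.hom ≫ Δ.mor₁ ≫ f.inv)
    have := r.isIso_iUpperStar_map hb hZ
    obtain ⟨C, h, δ, hC⟩ := distinguished_cocone_triangle a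
    have hB' := (compacts T).ext_of_isTriangulatedClosed₂ _ hb hB (r.compactImage_le _ hZ)
    have comm : r.iUpperStar.map a ≫ inv (r.iUpperStar.map b) ≫ f.hom = e.hom ≫ Δ.mor₁ := by
      simp [hab]
    exact ⟨C, (compacts T).ext_of_isTriangulatedClosed₃ _ hC hA hB',
      ⟨Triangle.π₃.mapIso (isoTriangleOfIso₁₂ _ _ (r.iUpperStar.map_distinguished _ hC) hΔ e
        ((asIso (r.iUpperStar.map b)).symm ≪≫ f) comm)⟩⟩)
  have := ObjectProperty.IsTriangulatedClosed₂.of_isTriangulatedClosed₃ (P := r.compactQuotient)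
  have : r.compactQuotient.ContainsZero := by
    obtain ⟨Z, hZ, hZ'⟩ := (compacts T).exists_prop_of_containsZero
    exact ⟨_, r.iUpperStar.map_isZero hZ, Z, hZ', ⟨Iso.refl _⟩⟩
  constructor

/-- Every compact object of `R` is a direct summand of the image of a compact object of `T`. -/
lemma exists_retract_iUpperStar (hR : IsCompactlyGenerated R) (hT : IsCompactlyGenerated T)
    (hS : IsCompactlyGenerated S) {G : R} (hG : compacts R G) :
    ∃ H : T, compacts T H ∧ Nonempty (Retract G (r.iUpperStar.obj H)) := by
  have := hR.hasCoproducts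
  have := hT.hasCoproducts
  have := r.compactQuotient_isTriangulated hS
  have := compactFactor_isTriangulated r.compactQuotient_le
  obtain ⟨I, Γ, hΓ⟩ := hT.exists_isCompactGenerating
  have hΓ' : IsCompactGenerating fun i => r.iUpperStar.obj (Γ i) :=
    { compact := fun i => r.compacts_iUpperStar (hΓ.compact i)
      shift := fun i => by
        obtain ⟨i', ⟨e⟩⟩ := hΓ.shift i
        exact ⟨i', ⟨r.iUpperStar.mapIso e ≪≫ (r.iUpperStar.commShiftIso (-1 : ℤ)).app _⟩⟩
      isZero := fun Y hY => by
        have h0 : IsZero (r.iLower.obj Y) := hΓ.isZero _ fun i f => by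
          apply (r.iAdjLeft.homEquiv _ _).symm.injective
          exact (hY i _).trans (hY i _).symm
        have := r.iLower_faithful
        rw [IsZero.iff_id_eq_zero]
        exact r.iLower.map_injective (h0.eq_of_src _ _) }
  -- Every map from a compact object of `R` factors through some `i^* H`; for the identity of `G`
  -- this is a retraction.
  obtain ⟨Z, a, b, ⟨H, hH, ⟨e⟩⟩, hab⟩ := hΓ'.prop (compactFactor r.compactQuotient)
    (fun i => le_compactFactor _ ⟨Γ i, hΓ.compact i, ⟨Iso.refl _⟩⟩)
    (fun J X hX => compactFactor_sigma J X hX) G G hG (𝟙 G)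
  exact ⟨H, hH, ⟨⟨a ≫ e.inv, e.hom ≫ b, by simpa using hab⟩⟩⟩

end Recollement

end Recollement
-- Functoriality of duals on retracts and isomorphisms
section Uniqueness

variable {T : Type u} [Category.{v} T] [Preadditive T] {k : Type w} [Field k] [Linear k T]

/-- A retraction between objects induces a retraction between their Brown–Comenetz duals. -/
lemma exists_retract_of_isTrace {G E H F : T} {t : Module.Dual k (G ⟶ E)}
    {s : Module.Dual k (H ⟶ F)} (ht : IsTrace t) (hs : IsTrace s) (e : Retract G H) :
    ∃ ρ : Retract E F, AreTransposed t s e.i ρ.i ∧ AreTransposed s t e.r ρ.r := by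
  obtain ⟨i, hi⟩ := exists_areTransposed_right hs t e.i
  obtain ⟨p, hp⟩ := exists_areTransposed_right ht s e.r
  refine ⟨⟨i, p, AreTransposed.right_unique ht (hi.comp hp) ?_⟩, hi, hp⟩
  rw [e.retract]
  exact AreTransposed.id t

lemma nonempty_iso_of_isTrace {G E H F : T} {t : Module.Dual k (G ⟶ E)}
    {s : Module.Dual k (H ⟶ F)} (ht : IsTrace t) (hs : IsTrace s) (e : G ≅ H) :
    Nonempty (E ≅ F) := by
  obtain ⟨i, hi⟩ := exists_areTransposed_right hs t e.hom
  obtain ⟨p, hp⟩ := exists_areTransposed_right ht s e.inv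
  refine ⟨⟨i, p, AreTransposed.right_unique ht (hi.comp hp) ?_,
    AreTransposed.right_unique hs (hp.comp hi) ?_⟩⟩
  · rw [e.hom_inv_id]
    exact AreTransposed.id t
  · rw [e.inv_hom_id]
    exact AreTransposed.id s

end Uniqueness

/-! ### Fullness and faithfulness on a localization by left fractions -/

section Localization

variable {C D E : Type*} [Category* C] [Category* D] [Category* E] {L : C ⥤ D}
  (W : MorphismProperty C) [L.IsLocalization W]
  {Φ : D ⥤ E} {G : C ⥤ E} (e : L ⋙ Φ ≅ G)

include e

lemma full_of_leftFraction (h : ∀ ⦃X Y : C⦄ (φ : G.obj X ⟶ G.obj Y),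
    ∃ (Y' : C) (a : X ⟶ Y') (s : Y ⟶ Y'), W s ∧ G.map a = φ ≫ G.map s) : Φ.Full := by
  have := Localization.essSurj L W
  have h' (X Y : C) (φ : Φ.obj (L.obj X) ⟶ Φ.obj (L.obj Y)) : ∃ p, Φ.map p = φ := by
    obtain ⟨Y', a, s, hs, has⟩ := h (e.inv.app X ≫ φ ≫ e.hom.app Y)
    have := Localization.inverts L W s hs
    refine ⟨L.map a ≫ inv (L.map s), ?_⟩
    rw [Functor.map_comp, Functor.map_inv, IsIso.comp_inv_eq, ← cancel_mono (e.hom.app Y'),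
      ← cancel_epi (e.inv.app X), Category.assoc]
    have h1 : Φ.map (L.map a) ≫ e.hom.app Y' = e.hom.app X ≫ G.map a := e.hom.naturality a
    have h2 : Φ.map (L.map s) ≫ e.hom.app Y' = e.hom.app Y ≫ G.map s := e.hom.naturality s
    rw [h1, h2, has]
    simp
  refine ⟨fun {A B} φ => ?_⟩
  let eA := L.objObjPreimageIso A
  let eB := L.objObjPreimageIso B
  obtain ⟨p, hp⟩ := h' _ _ (Φ.map eA.hom ≫ φ ≫ Φ.map eB.inv)
  refine ⟨eA.inv ≫ p ≫ eB.hom, ?_⟩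
  rw [Functor.map_comp, Functor.map_comp, hp, Category.assoc, Category.assoc, ← Φ.map_comp,
    ← Φ.map_comp_assoc]
  simp

lemma faithful_of_leftFraction [W.HasLeftCalculusOfFractions]
    (h : ∀ ⦃X Y : C⦄ (f g : X ⟶ Y), G.map f = G.map g →
    ∃ (Y' : C) (s : Y ⟶ Y'), W s ∧ f ≫ s = g ≫ s) : Φ.Faithful := by
  have := Localization.essSurj L W
  have h' (X Y : C) (p q : L.obj X ⟶ L.obj Y) (hpq : Φ.map p = Φ.map q) : p = q := by
    obtain ⟨⟨f, g, s, hs⟩, hp, hq⟩ := Localization.exists_leftFraction₂ L W p q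
    have := Localization.inverts L W s hs
    have hp' : p ≫ L.map s = L.map f := by 
      rw [hp]
      exact MorphismProperty.LeftFraction.map_comp_map_s ⟨f, s, hs⟩ L _
    have hq' : q ≫ L.map s = L.map g := by 
      rw [hq]
      exact MorphismProperty.LeftFraction.map_comp_map_s ⟨g, s, hs⟩ L _
    have hfg : G.map f = G.map g := by
      rw [← cancel_epi (e.hom.app X)]
      have h1 : Φ.map (L.map f) ≫ e.hom.app _ = e.hom.app X ≫ G.map f := e.hom.naturality f
      have h2 : Φ.map (L.map g) ≫ e.hom.app _ = e.hom.app X ≫ G.map g := e.hom.naturality g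
      rw [← h1, ← h2, ← hp', ← hq', Functor.map_comp, Functor.map_comp, hpq]
    obtain ⟨Y', s', hs', hfs⟩ := h f g hfg
    have := Localization.inverts L W s' hs'
    rw [← cancel_mono (L.map s), hp', hq', ← cancel_mono (L.map s'), ← L.map_comp, ← L.map_comp,
      hfs]
  refine ⟨fun {A B} p q hpq => ?_⟩
  let eA := L.objObjPreimageIso A
  let eB := L.objObjPreimageIso B
  have := h' _ _ (eA.hom ≫ p ≫ eB.inv) (eA.hom ≫ q ≫ eB.inv) (by
    simp only [Functor.map_comp, hpq])
  simpa using this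

end Localization

/-! ### Dualizing the localization statements -/

section Recollement

variable {k : Type w} [Field k]
  {R : Type u₁} [Category.{v} R] [Preadditive R] [HasZeroObject R] [HasShift R ℤ]
  [∀ n : ℤ, (shiftFunctor R n).Additive] [Pretriangulated R] [Linear k R]
  {T : Type u₂} [Category.{v} T] [Preadditive T] [HasZeroObject T] [HasShift T ℤ]
  [∀ n : ℤ, (shiftFunctor T n).Additive] [Pretriangulated T] [Linear k T]
  {S : Type u₃} [Category.{v} S] [Preadditive S] [HasZeroObject S] [HasShift S ℤ]
  [∀ n : ℤ, (shiftFunctor S n).Additive] [Pretriangulated S] [Linear k S]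

namespace Recollement

variable (r : Recollement k R T S)

/-- A morphism between Brown–Comenetz duals of compact objects which is killed by `i^!`
factors through `j_*` of such a dual. -/
lemma exists_factor_dual (hT : IsCompactlyGenerated T) (hT' : IsLocallyHomFinite T k)
    (hS : IsCompactlyGenerated S) {X Y : T} (hX : dualsOfCompacts T k X)
    (hY : dualsOfCompacts T k Y) (d : X ⟶ Y) (hd : r.iUpperShriek.map d = 0) :
    ∃ (E : S) (a : X ⟶ r.jLowerStar.obj E) (b : r.jLowerStar.obj E ⟶ Y),
      dualsOfCompacts S k E ∧ a ≫ b = d := by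
  have := hT.hasCoproducts
  obtain ⟨A, hA, hX⟩ := hX
  obtain ⟨B, hB, hY⟩ := hY
  obtain ⟨t, ht⟩ := isBrownComenetzDual_iff.1 hX
  obtain ⟨s, hs⟩ := isBrownComenetzDual_iff.1 hY
  have := hT' A B hA hB
  obtain ⟨g, hg⟩ := exists_areTransposed_left ht s d
  -- Both `i^* g` and `0` are transposes of `i^! d = 0`.
  have hg' : r.iUpperStar.map g = 0 := by
    refine AreTransposed.left_unique (ht.adjForm r.iAdjLeft r.iAdjRight)
      (hg.adjForm r.iAdjLeft r.iAdjRight) fun h => ?_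
    rw [hd, comp_zero, zero_comp, map_zero, map_zero]
  obtain ⟨Z, a, b, ⟨W, hW, ⟨e⟩⟩, hab⟩ := r.exists_factor hS hA g hg'
  obtain ⟨E, q, hq⟩ := hS.exists_isTrace k hW
  obtain ⟨a', ha'⟩ := exists_areTransposed_right (hq.adjForm r.jAdjLeft r.jAdjRight) t (a ≫ e.inv)
  obtain ⟨b', hb'⟩ := exists_areTransposed_right hs (adjForm r.jAdjLeft r.jAdjRight q) (e.hom ≫ b)
  refine ⟨E, a', b', ⟨W, hW, isBrownComenetzDual_iff.2 ⟨q, hq⟩⟩,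
    AreTransposed.right_unique hs (ha'.comp hb') ?_⟩
  simpa [hab] using hg

/-- A morphism between the images under `i^!` of Brown–Comenetz duals of compact objects is a
fraction of morphisms between such duals. -/
lemma exists_roof_dual [∀ n : ℤ, (shiftFunctor T n).Linear k] (hT : IsCompactlyGenerated T)
    (hR' : IsLocallyHomFinite R k) (hS : IsCompactlyGenerated S)
    {X Y : T} (hX : dualsOfCompacts T k X) (hY : dualsOfCompacts T k Y)
    (φ : r.iUpperShriek.obj X ⟶ r.iUpperShriek.obj Y) :
    ∃ (Y' : T) (a : X ⟶ Y') (s : Y ⟶ Y') (E : S) (p : Y' ⟶ r.jLowerStar.obj E)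
      (q : r.jLowerStar.obj E ⟶ Y⟦(1 : ℤ)⟧), dualsOfCompacts T k Y' ∧ dualsOfCompacts S k E ∧
      Triangle.mk s p q ∈ distTriang T ∧ r.iUpperShriek.map a = φ ≫ r.iUpperShriek.map s := by
  have := hT.hasCoproducts
  have := compacts_isTriangulated (T := T)
  obtain ⟨A, hA, hX⟩ := hX
  obtain ⟨B, hB, hY⟩ := hY
  obtain ⟨t, ht⟩ := isBrownComenetzDual_iff.1 hX
  obtain ⟨s, hs⟩ := isBrownComenetzDual_iff.1 hY
  have := hR' _ _ (r.compacts_iUpperStar hA) (r.compacts_iUpperStar hB)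
  obtain ⟨ψ, hψ⟩ := exists_areTransposed_left (ht.adjForm r.iAdjLeft r.iAdjRight)
    (adjForm r.iAdjLeft r.iAdjRight s) φ
  obtain ⟨B', Z, a, b, p, q, hb, hZ, hab⟩ := r.exists_roof hS hA ψ
  have hB' : compacts T B' :=
    (compacts T).ext_of_isTriangulatedClosed₂ _ hb hB (r.compactImage_le _ hZ)
  obtain ⟨Y', s', hs'⟩ := hT.exists_isTrace k hB'
  obtain ⟨a', ha'⟩ := exists_areTransposed_right hs' t a
  obtain ⟨b', hb'⟩ := exists_areTransposed_right hs' s b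
  obtain ⟨Q, p', q', hQ⟩ := distinguished_cocone_triangle b'
  obtain ⟨u, hu⟩ := exists_isTrace_cone hs hs' hb hQ hb'
  obtain ⟨W, hW, ⟨e⟩⟩ := hZ
  obtain ⟨E, w, hw⟩ := hS.exists_isTrace k hW
  -- The cone of `b'` is dual to `Z ≅ j_! W`, as is `j_* E` for `E` the dual of `W`; uniqueness of
  -- duals identifies them.
  obtain ⟨f⟩ := nonempty_iso_of_isTrace hu (hw.adjForm r.jAdjLeft r.jAdjRight) e.symm
  refine ⟨Y', a', b', E, p' ≫ f.hom, f.inv ≫ q', ⟨B', hB', isBrownComenetzDual_iff.2 ⟨s', hs'⟩⟩,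
    ⟨W, hW, isBrownComenetzDual_iff.2 ⟨w, hw⟩⟩, distTriang_of_iso₃ hQ f, ?_⟩
  refine AreTransposed.right_unique (hs'.adjForm r.iAdjLeft r.iAdjRight)
    (ha'.adjForm r.iAdjLeft r.iAdjRight) ?_
  rw [hab]
  exact hψ.comp (hb'.adjForm r.iAdjLeft r.iAdjRight)

/-- The Brown–Comenetz dual of a compact object of `R` is a direct summand of `i^!` of the
Brown–Comenetz dual of a compact object of `T`. -/
lemma exists_retract_dual (hR : IsCompactlyGenerated R) (hT : IsCompactlyGenerated T)
    (hS : IsCompactlyGenerated S) {E : R} (hE : dualsOfCompacts R k E) :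
    ∃ F : T, dualsOfCompacts T k F ∧ Nonempty (Retract E (r.iUpperShriek.obj F)) := by
  obtain ⟨G, hG, hE⟩ := hE
  obtain ⟨t, ht⟩ := isBrownComenetzDual_iff.1 hE
  obtain ⟨H, hH, ⟨e⟩⟩ := r.exists_retract_iUpperStar hR hT hS hG
  obtain ⟨F, s, hs⟩ := hT.exists_isTrace k hH
  obtain ⟨ρ, -⟩ := exists_retract_of_isTrace ht (hs.adjForm r.iAdjLeft r.iAdjRight) e
  exact ⟨F, ⟨H, hH, isBrownComenetzDual_iff.2 ⟨s, hs⟩⟩, ⟨ρ⟩⟩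

end Recollement

end Recollement
-- Verdier quotients of full subcategories, and retracts
section Quotient

variable {B : Type u₂} [Category.{v} B] [Preadditive B] [HasZeroObject B] [HasShift B ℤ]
  [∀ n : ℤ, (shiftFunctor B n).Additive] [Pretriangulated B]

/-- In a full triangulated subcategory, membership in the class of morphisms with cone in `N` may
be tested in the ambient category. -/
lemma trW_fullSubcategory {P : ObjectProperty B} [P.IsTriangulated]
    (N : ObjectProperty P.FullSubcategory) [N.IsClosedUnderIsomorphisms]
    {X Y Z : P.FullSubcategory} (s : X ⟶ Y) {p : Y.obj ⟶ Z.obj} {q : Z.obj ⟶ X.obj⟦(1 : ℤ)⟧}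
    (h : Triangle.mk s.hom p q ∈ distTriang B) (hZ : N Z) : N.trW s := by
  obtain ⟨C, b, c, hC⟩ := distinguished_cocone_triangle s
  have hC' := P.ι.map_distinguished _ hC
  let e : C.obj ≅ Z.obj := Triangle.π₃.mapIso (isoTriangleOfIso₁₂ _ _ hC' h (Iso.refl _)
    (Iso.refl _) ((Category.comp_id s.hom).trans (Category.id_comp s.hom).symm))
  exact ⟨C, b, c, hC, N.prop_of_iso (P.isoMk e).symm hZ⟩

/-- If a morphism factors through an object of a triangulated subcategory, it vanishes after
composition with a morphism whose cone is in the subcategory. -/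
lemma exists_trW_comp_eq {N : ObjectProperty B} [N.IsStableUnderShift ℤ] {X Y Z : B} {f g : X ⟶ Y}
    (hZ : N Z) (a : X ⟶ Z) (b : Z ⟶ Y) (h : a ≫ b = f - g) :
    ∃ (Y' : B) (s : Y ⟶ Y'), N.trW s ∧ f ≫ s = g ≫ s := by
  obtain ⟨Y', s, t, hs⟩ := distinguished_cocone_triangle b
  refine ⟨Y', s, ⟨_, _, _, rot_of_distTriang _ hs, N.le_shift 1 _ hZ⟩, ?_⟩
  rw [← sub_eq_zero, ← Preadditive.sub_comp, ← h, Category.assoc, distTriang_comp₁₂ hs, comp_zero]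

/-- Fractions extend along retracts. -/
lemma exists_leftFraction_of_retract {C D : Type*} [Category* C] [Category* D]
    {W : MorphismProperty C} [W.HasLeftCalculusOfFractions] {G : C ⥤ D} {X Y X₁ Y₁ : C}
    (x : Retract X X₁) (y : Retract Y Y₁)
    (h : ∀ φ : G.obj X₁ ⟶ G.obj Y₁, ∃ (Y' : C) (a : X₁ ⟶ Y') (s : Y₁ ⟶ Y'),
      W s ∧ G.map a = φ ≫ G.map s) (φ : G.obj X ⟶ G.obj Y) :
    ∃ (Y' : C) (a : X ⟶ Y') (s : Y ⟶ Y'), W s ∧ G.map a = φ ≫ G.map s := by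
  obtain ⟨Y', a, s, hs, has⟩ := h (G.map x.r ≫ φ ≫ G.map y.i)
  -- The Ore condition pushes the denominator `s` forward along the retraction `Y₁ ⟶ Y`.
  obtain ⟨⟨f, s', hs'⟩, hf⟩ := (MorphismProperty.RightFraction.mk s hs y.r).exists_leftFraction
  dsimp only at hf
  refine ⟨_, x.i ≫ a ≫ f, s', hs', ?_⟩
  simp only [Functor.map_comp, has, Category.assoc]
  rw [← G.map_comp s f, ← hf, ← G.map_comp_assoc x.i, x.retract, G.map_comp,
    ← G.map_comp_assoc y.i, y.retract]
  simp

end Quotient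

end BrownComenetz

open BrownComenetz in
theorem mainTheorem3
    {k : Type w} [Field k]
    {R : Type u₁} [Category.{v} R] [Preadditive R] [HasZeroObject R] [HasShift R ℤ]
    [∀ n : ℤ, (shiftFunctor R n).Additive] [Pretriangulated R] [IsTriangulated R]
    [Linear k R] [∀ n : ℤ, (shiftFunctor R n).Linear k]
    {T : Type u₂} [Category.{v} T] [Preadditive T] [HasZeroObject T] [HasShift T ℤ]
    [∀ n : ℤ, (shiftFunctor T n).Additive] [Pretriangulated T] [IsTriangulated T]
    [Linear k T] [∀ n : ℤ, (shiftFunctor T n).Linear k]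
    {S : Type u₃} [Category.{v} S] [Preadditive S] [HasZeroObject S] [HasShift S ℤ]
    [∀ n : ℤ, (shiftFunctor S n).Additive] [Pretriangulated S] [IsTriangulated S]
    [Linear k S] [∀ n : ℤ, (shiftFunctor S n).Linear k]
    (hR : BrownComenetz.IsCompactlyGenerated R) (hR' : BrownComenetz.IsLocallyHomFinite R k)
    (hT : BrownComenetz.IsCompactlyGenerated T) (hT' : BrownComenetz.IsLocallyHomFinite T k)
    (hS : BrownComenetz.IsCompactlyGenerated S) (hS' : BrownComenetz.IsLocallyHomFinite S k)
    (r : BrownComenetz.Recollement k R T S) :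
    ∃ (hj : ∀ X : S, BrownComenetz.dualSubcategory S k X →
          BrownComenetz.dualSubcategory T k (r.jLowerStar.obj X))
      (hi : ∀ X : T, BrownComenetz.dualSubcategory T k X →
          BrownComenetz.dualSubcategory R k (r.iUpperShriek.obj X)),
      BrownComenetz.IsShortExactUpToSummands
        ((BrownComenetz.dualSubcategory T k).lift
          ((BrownComenetz.dualSubcategory S k).ι ⋙ r.jLowerStar)
          (fun X => hj X.obj X.property))
        ((BrownComenetz.dualSubcategory R k).lift
          ((BrownComenetz.dualSubcategory T k).ι ⋙ r.iUpperShriek)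
          (fun X => hi X.obj X.property)) := by
  have hj := dualSubcategory_map (k := k) (F := r.jLowerStar)
    fun _ => r.dualsOfCompacts_jLowerStar
  have hi := dualSubcategory_map (k := k) (F := r.iUpperShriek)
    fun _ => r.dualsOfCompacts_iUpperShriek
  have := r.jLowerStar_full
  have := r.jLowerStar_faithful
  have := hT.hasCoproducts
  have := hR.hasCoproducts
  let F := (dualSubcategory T k).lift ((dualSubcategory S k).ι ⋙ r.jLowerStar)
    (fun X => hj X.obj X.property)
  let G := (dualSubcategory R k).lift ((dualSubcategory T k).ι ⋙ r.iUpperShriek)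
    (fun X => hi X.obj X.property)
  have hGF (X : (dualSubcategory S k).FullSubcategory) : IsZero (G.obj (F.obj X)) := by
    rw [IsZero.iff_id_eq_zero]
    ext
    exact (r.isZero_iUpperShriek_jLowerStar X.obj).eq_of_src _ _
  have hF (E : S) (hE : dualsOfCompacts S k E) :
      F.essImage ⟨r.jLowerStar.obj E, hj E (ObjectProperty.le_triangEnvelope _ _ hE)⟩ :=
    F.obj_mem_essImage ⟨E, ObjectProperty.le_triangEnvelope _ _ hE⟩
  have key (X : (dualSubcategory T k).FullSubcategory) :
      ∃ X₁ : (dualSubcategory T k).FullSubcategory, dualsOfCompacts T k X₁.obj ∧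
        Nonempty (Retract X X₁) := by
    obtain ⟨X₁, hX₁, ⟨e⟩⟩ := dualSubcategory_le_retractClosure hT' _ X.property
    exact ⟨⟨X₁, ObjectProperty.le_triangEnvelope _ _ hX₁⟩, hX₁,
      ⟨⟨ObjectProperty.homMk e.i, ObjectProperty.homMk e.r, by ext; exact e.retract⟩⟩⟩
  have : (verdierW F).HasLeftCalculusOfFractions :=
    inferInstanceAs F.essImage.trW.HasLeftCalculusOfFractions
  let e : (verdierW F).Q ⋙ verdierInduced F G hGF ≅ G :=
    eqToIso (Localization.Construction.fac _ _)
  refine ⟨hj, hi, inferInstanceAs F.Full, inferInstanceAs F.Faithful, hGF,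
    full_of_leftFraction (verdierW F) e fun X Y => ?_,
    faithful_of_leftFraction (verdierW F) e fun X Y f g hfg => ?_, fun Y => ?_⟩
  · obtain ⟨X₁, hX₁, ⟨x⟩⟩ := key X
    obtain ⟨Y₁, hY₁, ⟨y⟩⟩ := key Y
    refine exists_leftFraction_of_retract x y fun φ => ?_
    obtain ⟨Y', a, s, E, p, q, hY', hE, h, has⟩ := r.exists_roof_dual hT hR' hS hX₁ hY₁ φ.hom
    let Y'' : (dualSubcategory T k).FullSubcategory :=
      ⟨Y', ObjectProperty.le_triangEnvelope _ _ hY'⟩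
    let s' : Y₁ ⟶ Y'' := ObjectProperty.homMk s
    exact ⟨Y'', ObjectProperty.homMk a, s',
      trW_fullSubcategory (Z := ⟨_, hj E (ObjectProperty.le_triangEnvelope _ _ hE)⟩)
        F.essImage s' (p := p) (q := q) h (hF E hE), by ext; exact has⟩
  · obtain ⟨X₁, hX₁, ⟨x⟩⟩ := key X
    obtain ⟨Y₁, hY₁, ⟨y⟩⟩ := key Y
    have hfg' : r.iUpperShriek.map f.hom = r.iUpperShriek.map g.hom := congr($(hfg).hom)
    -- Conjugated by the retractions, `f - g` becomes a map of duals of compacts killed by `i^!`.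
    -- Its factorization through `j_* E`, composed with `x.i` and `y.r`, factors `f - g` itself.
    obtain ⟨E, a, b, hE, hab⟩ := r.exists_factor_dual hT hT' hS hX₁ hY₁
      (x.r.hom ≫ (f.hom - g.hom) ≫ y.i.hom) (by
        rw [Functor.map_comp, Functor.map_comp, Functor.map_sub, hfg', sub_self, zero_comp,
          comp_zero])
    refine exists_trW_comp_eq (hF E hE) (x.i ≫ ObjectProperty.homMk a)
      (ObjectProperty.homMk b ≫ y.r) ?_
    have hx : x.i.hom ≫ x.r.hom = 𝟙 _ := congr($(x.retract).hom)
    have hy : y.i.hom ≫ y.r.hom = 𝟙 _ := congr($(y.retract).hom)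
    ext
    change (x.i.hom ≫ a) ≫ b ≫ y.r.hom = f.hom - g.hom
    rw [Category.assoc, reassoc_of% hab, hy, Category.comp_id, reassoc_of% hx]
  · obtain ⟨E, hE, ⟨ρ⟩⟩ := dualSubcategory_le_retractClosure hR' _ Y.property
    obtain ⟨X, hX, ⟨σ⟩⟩ := r.exists_retract_dual hR hT hS hE
    refine ⟨(verdierW F).Q.obj ⟨X, ObjectProperty.le_triangEnvelope _ _ hX⟩,
      ⟨⟨ObjectProperty.homMk (ρ.i ≫ σ.i), ObjectProperty.homMk (σ.r ≫ ρ.r), ?_⟩⟩⟩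
    ext
    exact (ρ.trans σ).retract
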